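/- Let $A$ be an algebra over $\mathbb C$, possibly without identity, with non-degenerate product, and let $(A,\Delta)$ be a regular multiplier Hopf algebra: $\Delta:A\to M(A\otimes A)$ is a coassociative homomorphism and the maps $a\otimes b\mapsto \Delta(a)(1\otimes b)$, $(a\otimes 1)\Delta(b)$, $\Delta(a)(b\otimes 1)$, $(1\otimes a)\Delta(b)$ are bijections of $A\otimes A$ onto itself. Let $\varphi$ be a left integral, that is, a non-zero linear functional on $A$ with $(\iota\otimes\varphi)\Delta(a)=\varphi(a)1$ in $M(A)$ for all $a\in A$. Then $(A,\Delta)$ has a unique counit $\varepsilon$ and a unique (bijective) antipode $S:A\to A$. Put $\psi=\varphi\circ S$. Let $B=\widehat A=\{\varphi(\,\cdot\,a): a\in A\}$ be the dual, a space of linear functionals on $A$, with pairing $\langle a,b\rangle=b(a)$, with the product $\langle a,bb'\rangle=\langle\Delta(a),b\otimes b'\rangle$ and the coproduct adjoint to the product of $A$. Then $B$ has a unique bijective antipode $S$, and $\langle a,S(b)\rangle=\langle S(a),b\rangle$ for $a\in A$, $b\in B$. The maps $a\mapsto\varphi(\,\cdot\,a)$ and $a\mapsto\psi(S(\,\cdot\,)a)$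 are linear bijections from $A$ onto $B$, so that linear functionals $\widehat\psi$ and $\widehat\varphi$ on $B$ are well defined by $$\widehat\psi(\varphi(\,\cdot\,a))=\varepsilon(a),\qquad \widehat\varphi(\psi(S(\,\cdot\,)a))=\varepsilon(a)\qquad(a\in A).$$ Moreover: (1) The inverse of the map $a\mapsto\varphi(\,\cdot\,a)$ from $A$ to $B$ is the map $b\mapsto\widehat\psi(S(\,\cdot\,)b)$ from $B$ to $A$. That is, if $b\in B$, then the element $a\in A$ with $b=\varphi(\,\cdot\,a)$ is the only element of $A$ satisfying $\langle a,b'\rangle=\widehat\psi(S(b')b)$ for all $b'\in B$. (2) The inverse of the map $a\mapsto\psi(S(\,\cdot\,)a)$ from $A$ to $B$ is the map $b\mapsto\widehat\varphi(\,\cdot\,b)$ from $B$ to $A$. That is, if $b\in B$, then the element $a\in A$ with $b=\psi(S(\,\cdot\,)a)$ is the only element of $A$ satisfying $\langle a,b'\rangle=\widehat\varphi(b'b)$ for all $b'\in B$. -/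

import Mathlib

open scoped TensorProduct

noncomputable section

namespace MHA

/-- The multiplier algebra `M(R)` of a (non-degenerate, possibly non-unital) complex algebra `R`.
A multiplier `m` is the pair of linear maps `x ↦ m x` and `x ↦ x m` of `R` into itself, subject to
`(x m) y = x (m y)`. The product is `(m n) x = m (n x)` and `x (m n) = (x m) n`. -/
def MultiplierAlgebra (R : Type*) [NonUnitalRing R] [Module ℂ R] [IsScalarTower ℂ R R]
    [SMulCommClass ℂ R R] : Subalgebra ℂ (Module.End ℂ R × (Module.End ℂ R)ᵐᵒᵖ) where
  carrier := {p | ∀ x y : R, p.2.unop x * y = x * p.1 y}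
  mul_mem' := by
    intro p q hp hq x y
    simp only [Prod.snd_mul, Prod.fst_mul, MulOpposite.unop_mul, Module.End.mul_apply]
    rw [hq, hp]
  add_mem' := by
    intro p q hp hq x y
    simp only [Prod.snd_add, Prod.fst_add, MulOpposite.unop_add, LinearMap.add_apply, add_mul,
      mul_add, hp x y, hq x y]
  algebraMap_mem' := by
    intro r x y
    simp [Prod.algebraMap_apply, MulOpposite.algebraMap_apply, Module.algebraMap_end_apply,
      smul_mul_assoc, mul_smul_comm]

section Multipliers

variable {R : Type*} [NonUnitalRing R] [Module ℂ R] [IsScalarTower ℂ R R] [SMulCommClass ℂ R R]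

/-- The action `x ↦ m x` of a multiplier `m`. -/
def leftMul (m : MultiplierAlgebra R) : R →ₗ[ℂ] R := m.1.1

/-- The action `x ↦ x m` of a multiplier `m`. -/
def rightMul (m : MultiplierAlgebra R) : R →ₗ[ℂ] R := m.1.2.unop

/-- An element of `R`, regarded as an element of `M(R)`. -/
def ofElem (r : R) : MultiplierAlgebra R :=
  ⟨(LinearMap.mulLeft ℂ r, MulOpposite.op (LinearMap.mulRight ℂ r)), fun x y => by
    simp [mul_assoc]⟩

/-- The product of `R` is non-degenerate. -/
def NondegenerateProduct (R : Type*) [NonUnitalRing R] : Prop :=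
  (∀ a : R, (∀ b : R, a * b = 0) → a = 0) ∧ (∀ b : R, (∀ a : R, a * b = 0) → b = 0)

theorem rightMul_mul_eq (m : MultiplierAlgebra R) (x y : R) :
    rightMul m x * y = x * leftMul m y := m.2 x y

theorem leftMul_mul (hR : NondegenerateProduct R) (m : MultiplierAlgebra R)
    (x y : R) : leftMul m (x * y) = leftMul m x * y := by
  rw [← sub_eq_zero]
  refine hR.2 _ fun z => ?_
  rw [mul_sub, ← rightMul_mul_eq, ← mul_assoc, rightMul_mul_eq, mul_assoc, sub_self]

end Multipliers

section Slices

variable {V : Type*} [AddCommMonoid V] [Module ℂ V]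

/-- The slice map `ω ⊗ ι : V ⊗ V → V`. -/
def sliceLeft (ω : Module.Dual ℂ V) : V ⊗[ℂ] V →ₗ[ℂ] V :=
  (TensorProduct.lid ℂ V).toLinearMap ∘ₗ TensorProduct.map ω LinearMap.id

/-- The slice map `ι ⊗ ω : V ⊗ V → V`. -/
def sliceRight (ω : Module.Dual ℂ V) : V ⊗[ℂ] V →ₗ[ℂ] V :=
  (TensorProduct.rid ℂ V).toLinearMap ∘ₗ TensorProduct.map LinearMap.id ω

@[simp] theorem sliceLeft_tmul (ω : Module.Dual ℂ V) (a b : V) :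
    sliceLeft ω (a ⊗ₜ b) = ω a • b := by simp [sliceLeft]

@[simp] theorem sliceRight_tmul (ω : Module.Dual ℂ V) (a b : V) :
    sliceRight ω (a ⊗ₜ b) = ω b • a := by simp [sliceRight]

end Slices

section Tensor

variable {A : Type*} [NonUnitalRing A] [Module ℂ A] [IsScalarTower ℂ A A] [SMulCommClass ℂ A A]

/-- The multiplier `1 ⊗ b` of `A ⊗ A`. -/
def oneTmul (b : A) : MultiplierAlgebra (A ⊗[ℂ] A) :=
  ⟨(TensorProduct.map LinearMap.id (LinearMap.mulLeft ℂ b),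
    MulOpposite.op (TensorProduct.map LinearMap.id (LinearMap.mulRight ℂ b))), fun x y => by
    induction x with
    | zero => simp
    | add x₁ x₂ h₁ h₂ => simp only [map_add, add_mul, h₁, h₂]
    | tmul p q =>
      induction y with
      | zero => simp
      | add y₁ y₂ h₁ h₂ => simp only [map_add, mul_add, h₁, h₂]
      | tmul r s => simp [mul_assoc]⟩

/-- The multiplier `a ⊗ 1` of `A ⊗ A`. -/
def tmulOne (a : A) : MultiplierAlgebra (A ⊗[ℂ] A) :=
  ⟨(TensorProduct.map (LinearMap.mulLeft ℂ a) LinearMap.id,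
    MulOpposite.op (TensorProduct.map (LinearMap.mulRight ℂ a) LinearMap.id)), fun x y => by
    induction x with
    | zero => simp
    | add x₁ x₂ h₁ h₂ => simp only [map_add, add_mul, h₁, h₂]
    | tmul p q =>
      induction y with
      | zero => simp
      | add y₁ y₂ h₁ h₂ => simp only [map_add, mul_add, h₁, h₂]
      | tmul r s => simp [mul_assoc]⟩

/-- The functional `ω ⊗ ω'` on `A ⊗ A`. -/
def tensorFunctional (ω ω' : Module.Dual ℂ A) : Module.Dual ℂ (A ⊗[ℂ] A) :=
  (TensorProduct.lid ℂ ℂ).toLinearMap ∘ₗ TensorProduct.map ω ω'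

/-- The product of `A`, as a linear map `A ⊗ A → A`. -/
def mulTensor (A : Type*) [NonUnitalRing A] [Module ℂ A] [IsScalarTower ℂ A A]
    [SMulCommClass ℂ A A] : A ⊗[ℂ] A →ₗ[ℂ] A :=
  TensorProduct.lift (LinearMap.mul ℂ A)

@[simp] theorem tensorFunctional_tmul (ω ω' : Module.Dual ℂ A) (a b : A) :
    tensorFunctional ω ω' (a ⊗ₜ b) = ω a * ω' b := by simp [tensorFunctional]

@[simp] theorem mulTensor_tmul (a b : A) : mulTensor A (a ⊗ₜ b) = a * b := by simp [mulTensor]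

theorem eq_zero_of_sliceLeft (z : A ⊗[ℂ] A) (h : ∀ ω, sliceLeft ω z = 0) : z = 0 := by
  classical
  let e := Module.Basis.ofVectorSpace ℂ A
  apply (TensorProduct.equivFinsuppOfBasisLeft (N := A) e).injective
  rw [map_zero]
  ext i
  have key : ∀ z : A ⊗[ℂ] A,
      TensorProduct.equivFinsuppOfBasisLeft e z i = sliceLeft (e.coord i) z := by
    intro z
    induction z with
    | zero => simp
    | add x y hx hy => simp [hx, hy]
    | tmul a b => simp [TensorProduct.equivFinsuppOfBasisLeft_apply_tmul]
  rw [key, h]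
  rfl

theorem eq_zero_of_sliceRight (z : A ⊗[ℂ] A) (h : ∀ ω, sliceRight ω z = 0) : z = 0 := by
  have h' : TensorProduct.comm ℂ A A z = 0 := by
    refine eq_zero_of_sliceLeft _ fun ω => ?_
    rw [← h ω]
    induction z with
    | zero => simp
    | add x y hx hy =>
      have key : ∀ z : A ⊗[ℂ] A, sliceLeft ω (TensorProduct.comm ℂ A A z) = sliceRight ω z := by
        intro z
        induction z with
        | zero => simp
        | add x y hx hy => simp [hx, hy]
        | tmul a b => simp
      exact key _
    | tmul a b => simp
  simpa using h'

theorem eq_zero_of_mulRight_snd (hA : NondegenerateProduct A) (z : A ⊗[ℂ] A)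
    (h : ∀ v : A, TensorProduct.map LinearMap.id (LinearMap.mulRight ℂ v) z = 0) : z = 0 := by
  refine eq_zero_of_sliceLeft z fun ω => hA.1 _ fun v => ?_
  have key : ∀ z : A ⊗[ℂ] A, sliceLeft ω z * v =
      sliceLeft ω (TensorProduct.map LinearMap.id (LinearMap.mulRight ℂ v) z) := by
    intro z
    induction z with
    | zero => simp
    | add x y hx hy => simp [hx, hy, add_mul]
    | tmul a b => simp [smul_mul_assoc]
  rw [key, h, map_zero]

theorem eq_zero_of_mulRight_fst (hA : NondegenerateProduct A) (z : A ⊗[ℂ] A)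
    (h : ∀ u : A, TensorProduct.map (LinearMap.mulRight ℂ u) LinearMap.id z = 0) : z = 0 := by
  refine eq_zero_of_sliceRight z fun ω => hA.1 _ fun u => ?_
  have key : ∀ z : A ⊗[ℂ] A, sliceRight ω z * u =
      sliceRight ω (TensorProduct.map (LinearMap.mulRight ℂ u) LinearMap.id z) := by
    intro z
    induction z with
    | zero => simp
    | add x y hx hy => simp [hx, hy, add_mul]
    | tmul a b => simp [smul_mul_assoc]
  rw [key, h, map_zero]

theorem eq_zero_of_mulLeft_snd (hA : NondegenerateProduct A) (z : A ⊗[ℂ] A)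
    (h : ∀ v : A, TensorProduct.map LinearMap.id (LinearMap.mulLeft ℂ v) z = 0) : z = 0 := by
  refine eq_zero_of_sliceLeft z fun ω => hA.2 _ fun v => ?_
  have key : ∀ z : A ⊗[ℂ] A, v * sliceLeft ω z =
      sliceLeft ω (TensorProduct.map LinearMap.id (LinearMap.mulLeft ℂ v) z) := by
    intro z
    induction z with
    | zero => simp
    | add x y hx hy => simp [hx, hy, mul_add]
    | tmul a b => simp [mul_smul_comm]
  rw [key, h, map_zero]

theorem eq_zero_of_mulLeft_fst (hA : NondegenerateProduct A) (z : A ⊗[ℂ] A)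
    (h : ∀ u : A, TensorProduct.map (LinearMap.mulLeft ℂ u) LinearMap.id z = 0) : z = 0 := by
  refine eq_zero_of_sliceRight z fun ω => hA.2 _ fun u => ?_
  have key : ∀ z : A ⊗[ℂ] A, u * sliceRight ω z =
      sliceRight ω (TensorProduct.map (LinearMap.mulLeft ℂ u) LinearMap.id z) := by
    intro z
    induction z with
    | zero => simp
    | add x y hx hy => simp [hx, hy, mul_add]
    | tmul a b => simp [mul_smul_comm]
  rw [key, h, map_zero]

theorem mul_tmul_eq (z : A ⊗[ℂ] A) (u v : A) : z * (u ⊗ₜ[ℂ] v) =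
    TensorProduct.map LinearMap.id (LinearMap.mulRight ℂ v)
      (TensorProduct.map (LinearMap.mulRight ℂ u) LinearMap.id z) := by
  induction z with
  | zero => simp
  | add x y hx hy => simp [hx, hy, add_mul]
  | tmul a b => simp

theorem tmul_mul_eq (z : A ⊗[ℂ] A) (u v : A) : (u ⊗ₜ[ℂ] v) * z =
    TensorProduct.map LinearMap.id (LinearMap.mulLeft ℂ v)
      (TensorProduct.map (LinearMap.mulLeft ℂ u) LinearMap.id z) := by
  induction z with
  | zero => simp
  | add x y hx hy => simp [hx, hy, mul_add]
  | tmul a b => simp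

theorem NondegenerateProduct.tensor (hA : NondegenerateProduct A) :
    NondegenerateProduct (A ⊗[ℂ] A) := by
  constructor
  · intro z h
    refine eq_zero_of_mulRight_fst hA z fun u => eq_zero_of_mulRight_snd hA _ fun v => ?_
    rw [← mul_tmul_eq, h]
  · intro z h
    refine eq_zero_of_mulLeft_fst hA z fun u => eq_zero_of_mulLeft_snd hA _ fun v => ?_
    rw [← tmul_mul_eq, h]

end Tensor

/-- A regular multiplier Hopf algebra structure on the complex algebra `A`: the product of `A` is
non-degenerate, the coproduct `Δ : A → M(A ⊗ A)` is a homomorphism, all the products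
`Δ(a)(1 ⊗ b)`, `(a ⊗ 1)Δ(b)`, `Δ(a)(b ⊗ 1)`, `(1 ⊗ a)Δ(b)` lie in `A ⊗ A` and induce bijections
of `A ⊗ A` (these bijections `T₁`, `T₂`, `T₃`, `T₄` are determined by `Δ`), and `Δ` is
coassociative:
`(a ⊗ 1 ⊗ 1)(Δ ⊗ ι)(Δ(b)(1 ⊗ c)) = (ι ⊗ Δ)((a ⊗ 1)Δ(b))(1 ⊗ 1 ⊗ c)`. -/
structure RegularMultiplierHopfAlgebra (A : Type*) [NonUnitalRing A] [Module ℂ A]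
    [IsScalarTower ℂ A A] [SMulCommClass ℂ A A] where
  nondegenerate : NondegenerateProduct A
  Δ : A →ₙₐ[ℂ] MultiplierAlgebra (A ⊗[ℂ] A)
  T₁ : (A ⊗[ℂ] A) ≃ₗ[ℂ] (A ⊗[ℂ] A)
  of_T₁ : ∀ a b : A, ofElem (T₁ (a ⊗ₜ b)) = Δ a * oneTmul b
  T₂ : (A ⊗[ℂ] A) ≃ₗ[ℂ] (A ⊗[ℂ] A)
  of_T₂ : ∀ a b : A, ofElem (T₂ (a ⊗ₜ b)) = tmulOne a * Δ b
  T₃ : (A ⊗[ℂ] A) ≃ₗ[ℂ] (A ⊗[ℂ] A)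
  of_T₃ : ∀ a b : A, ofElem (T₃ (a ⊗ₜ b)) = Δ a * tmulOne b
  T₄ : (A ⊗[ℂ] A) ≃ₗ[ℂ] (A ⊗[ℂ] A)
  of_T₄ : ∀ a b : A, ofElem (T₄ (a ⊗ₜ b)) = oneTmul a * Δ b
  coassoc : ∀ a b c : A,
    TensorProduct.map T₂.toLinearMap LinearMap.id
        ((TensorProduct.assoc ℂ A A A).symm (a ⊗ₜ T₁ (b ⊗ₜ c))) =
      (TensorProduct.assoc ℂ A A A).symm
        (TensorProduct.map LinearMap.id T₁.toLinearMap
          (TensorProduct.assoc ℂ A A A (T₂ (a ⊗ₜ b) ⊗ₜ c)))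

/-- The linear map `a ↦ ω(· a)` from `A` to its dual space. -/
def rightTranslate {A : Type*} [NonUnitalRing A] [Module ℂ A] [IsScalarTower ℂ A A]
    [SMulCommClass ℂ A A] (ω : Module.Dual ℂ A) : A →ₗ[ℂ] Module.Dual ℂ A where
  toFun a := ω ∘ₗ LinearMap.mulRight ℂ a
  map_add' a b := by ext x; simp [mul_add]
  map_smul' r a := by ext x; simp [mul_smul_comm]

/-- The underlying space of the dual `Â`: the functionals `φ(· a)` with `a ∈ A`. The pairing of
`A` with `Â` is evaluation. -/
def dualSpace {A : Type*} [NonUnitalRing A] [Module ℂ A] [IsScalarTower ℂ A A]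
    [SMulCommClass ℂ A A] (φ : Module.Dual ℂ A) : Submodule ℂ (Module.Dual ℂ A) :=
  LinearMap.range (rightTranslate φ)

namespace RegularMultiplierHopfAlgebra

variable {A : Type*} [NonUnitalRing A] [Module ℂ A] [IsScalarTower ℂ A A] [SMulCommClass ℂ A A]
variable (H : RegularMultiplierHopfAlgebra A)

/-- `ε` is a counit: a homomorphism `A → ℂ` such that `(ε ⊗ ι)(Δ(a)(1 ⊗ b)) = ab` and
`(ι ⊗ ε)((a ⊗ 1)Δ(b)) = ab`. -/
def IsCounit (ε : A →ₙₐ[ℂ] ℂ) : Prop :=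
  (∀ a b : A, sliceLeft (ε : A →ₗ[ℂ] ℂ) (H.T₁ (a ⊗ₜ b)) = a * b) ∧
    (∀ a b : A, sliceRight (ε : A →ₗ[ℂ] ℂ) (H.T₂ (a ⊗ₜ b)) = a * b)

/-- `S` is an antipode (for the counit `ε`): with `m` the product,
`m((S ⊗ ι)(Δ(a)(1 ⊗ b))) = ε(a)b` and `m((ι ⊗ S)((a ⊗ 1)Δ(b))) = ε(b)a`. -/
def IsAntipode (ε : A →ₙₐ[ℂ] ℂ) (S : A ≃ₗ[ℂ] A) : Prop :=
  (∀ a b : A, mulTensor A (TensorProduct.map S.toLinearMap LinearMap.id (H.T₁ (a ⊗ₜ b)))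
      = ε a • b) ∧
    (∀ a b : A, mulTensor A (TensorProduct.map LinearMap.id S.toLinearMap (H.T₂ (a ⊗ₜ b)))
      = ε b • a)

/-- `φ` is a left integral: a non-zero functional with `(ι ⊗ φ)Δ(a) = φ(a)1` in `M(A)`, that is,
`(ι ⊗ φ)(Δ(a)(b ⊗ 1)) = φ(a)b` and `(ι ⊗ φ)((b ⊗ 1)Δ(a)) = φ(a)b`. -/
def IsLeftIntegral (φ : Module.Dual ℂ A) : Prop :=
  φ ≠ 0 ∧ (∀ a b : A, sliceRight φ (H.T₃ (a ⊗ₜ b)) = φ a • b) ∧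
    (∀ a b : A, sliceRight φ (H.T₂ (b ⊗ₜ a)) = φ a • b)

/-- The functional `a ↦ ⟨Δ(a), φ(· c) ⊗ φ(· c')⟩ = (φ ⊗ φ)(Δ(a)(c ⊗ c'))`. -/
def convolution (φ : Module.Dual ℂ A) (c c' : A) : Module.Dual ℂ A where
  toFun a := tensorFunctional φ φ (leftMul (H.Δ a) (c ⊗ₜ c'))
  map_add' a b := by simp [leftMul]
  map_smul' r a := by simp [leftMul]

theorem convolution_apply (φ : Module.Dual ℂ A) (c c' a : A) :
    H.convolution φ c c' a = tensorFunctional φ φ (leftMul (H.Δ a) (c ⊗ₜ c')) := rfl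

theorem left_tmul_eq_T₁ (a c c' : A) : leftMul (H.Δ a) (c ⊗ₜ c') =
    TensorProduct.map (LinearMap.mulRight ℂ c) LinearMap.id (H.T₁ (a ⊗ₜ c')) := by
  rw [← sub_eq_zero]
  refine eq_zero_of_mulRight_snd H.nondegenerate _ fun v =>
    eq_zero_of_mulRight_fst H.nondegenerate _ fun u => ?_
  have h := congrArg (fun m => leftMul m ((c * u) ⊗ₜ[ℂ] v)) (H.of_T₁ a c')
  have h₂ : H.T₁ (a ⊗ₜ c') * ((c * u) ⊗ₜ[ℂ] v) = leftMul (H.Δ a) ((c * u) ⊗ₜ[ℂ] (c' * v)) := h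
  have h₃ : leftMul (H.Δ a) ((c * u) ⊗ₜ[ℂ] (c' * v))
      = leftMul (H.Δ a) (c ⊗ₜ c') * (u ⊗ₜ[ℂ] v) := by
    rw [← leftMul_mul H.nondegenerate.tensor]
    simp
  rw [h₃] at h₂
  have k₁ : ∀ z : A ⊗[ℂ] A, TensorProduct.map (LinearMap.mulRight ℂ u) LinearMap.id
      (TensorProduct.map LinearMap.id (LinearMap.mulRight ℂ v) z) = z * (u ⊗ₜ[ℂ] v) := by
    intro z
    induction z with
    | zero => simp
    | add x y hx hy => simp only [map_add, hx, hy, add_mul]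
    | tmul a b => simp
  have k₂ : ∀ z : A ⊗[ℂ] A, TensorProduct.map (LinearMap.mulRight ℂ c) LinearMap.id z *
      (u ⊗ₜ[ℂ] v) = z * ((c * u) ⊗ₜ[ℂ] v) := by
    intro z
    induction z with
    | zero => simp
    | add x y hx hy => simp only [map_add, hx, hy, add_mul]
    | tmul a b => simp [mul_assoc]
  rw [k₁, sub_mul, k₂, h₂, sub_self]

theorem left_tmul_eq_T₃ (a c c' : A) : leftMul (H.Δ a) (c ⊗ₜ c') =
    TensorProduct.map LinearMap.id (LinearMap.mulRight ℂ c') (H.T₃ (a ⊗ₜ c)) := by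
  rw [← sub_eq_zero]
  refine eq_zero_of_mulRight_snd H.nondegenerate _ fun v =>
    eq_zero_of_mulRight_fst H.nondegenerate _ fun u => ?_
  have h := congrArg (fun m => leftMul m (u ⊗ₜ[ℂ] (c' * v))) (H.of_T₃ a c)
  have h₂ : H.T₃ (a ⊗ₜ c) * (u ⊗ₜ[ℂ] (c' * v)) = leftMul (H.Δ a) ((c * u) ⊗ₜ[ℂ] (c' * v)) := h
  have h₃ : leftMul (H.Δ a) ((c * u) ⊗ₜ[ℂ] (c' * v))
      = leftMul (H.Δ a) (c ⊗ₜ c') * (u ⊗ₜ[ℂ] v) := by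
    rw [← leftMul_mul H.nondegenerate.tensor]
    simp
  rw [h₃] at h₂
  have k₁ : ∀ z : A ⊗[ℂ] A, TensorProduct.map (LinearMap.mulRight ℂ u) LinearMap.id
      (TensorProduct.map LinearMap.id (LinearMap.mulRight ℂ v) z) = z * (u ⊗ₜ[ℂ] v) := by
    intro z
    induction z with
    | zero => simp
    | add x y hx hy => simp only [map_add, hx, hy, add_mul]
    | tmul a b => simp
  have k₂ : ∀ z : A ⊗[ℂ] A, TensorProduct.map LinearMap.id (LinearMap.mulRight ℂ c') z *
      (u ⊗ₜ[ℂ] v) = z * (u ⊗ₜ[ℂ] (c' * v)) := by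
    intro z
    induction z with
    | zero => simp
    | add x y hx hy => simp only [map_add, hx, hy, add_mul]
    | tmul a b => simp [mul_assoc]
  rw [k₁, sub_mul, k₂, h₂, sub_self]

theorem convolution_eq_T₁ (φ : Module.Dual ℂ A) (c c' a : A) : H.convolution φ c c' a
    = tensorFunctional (rightTranslate φ c) φ (H.T₁ (a ⊗ₜ c')) := by
  rw [convolution_apply, left_tmul_eq_T₁]
  generalize H.T₁ (a ⊗ₜ c') = z
  induction z with
  | zero => simp
  | add x y hx hy => simp only [map_add, hx, hy]
  | tmul a b => simp [rightTranslate]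

theorem convolution_eq_T₃ (φ : Module.Dual ℂ A) (c c' a : A) : H.convolution φ c c' a
    = tensorFunctional φ (rightTranslate φ c') (H.T₃ (a ⊗ₜ c)) := by
  rw [convolution_apply, left_tmul_eq_T₃]
  generalize H.T₃ (a ⊗ₜ c) = z
  induction z with
  | zero => simp
  | add x y hx hy => simp only [map_add, hx, hy]
  | tmul a b => simp [rightTranslate]

/-- The functional `convolution φ c c'` depends only on `φ(· c)` and `φ(· c')`. -/
theorem convolution_congr (φ : Module.Dual ℂ A) {c d c' d' : A}
    (h : rightTranslate φ c = rightTranslate φ d)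
    (h' : rightTranslate φ c' = rightTranslate φ d') :
    H.convolution φ c c' = H.convolution φ d d' := by
  ext a
  rw [convolution_eq_T₁, h, ← convolution_eq_T₁, convolution_eq_T₃, h', ← convolution_eq_T₃]

theorem left_T₃ (a : A) (p q : A) :
    leftMul (H.Δ a) (H.T₃ (p ⊗ₜ q)) = H.T₃ ((a * p) ⊗ₜ q) := by
  rw [← sub_eq_zero]
  refine H.nondegenerate.tensor.1 _ fun y => ?_
  rw [sub_mul, ← leftMul_mul H.nondegenerate.tensor]
  have h₁ : H.T₃ (p ⊗ₜ q) * y = leftMul (H.Δ p) (leftMul (tmulOne q) y) :=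
    congrArg (fun m => leftMul m y) (H.of_T₃ p q)
  have h₂ : H.T₃ ((a * p) ⊗ₜ q) * y = leftMul (H.Δ (a * p)) (leftMul (tmulOne q) y) :=
    congrArg (fun m => leftMul m y) (H.of_T₃ (a * p) q)
  rw [h₁, h₂, map_mul]
  exact sub_self _

/-- `Â` is closed under the product. -/
theorem convolution_mem {φ : Module.Dual ℂ A} (hφ : H.IsLeftIntegral φ) (c c' : A) :
    H.convolution φ c c' ∈ dualSpace φ := by
  have key : ∀ z : A ⊗[ℂ] A, ∃ d : A, ∀ a : A,
      tensorFunctional φ φ (leftMul (H.Δ a) (H.T₃ z)) = φ (a * d) := by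
    intro z
    induction z with
    | zero => exact ⟨0, fun a => by simp⟩
    | add x y hx hy =>
      obtain ⟨d, hd⟩ := hx
      obtain ⟨e, he⟩ := hy
      exact ⟨d + e, fun a => by simp only [map_add, hd, he, mul_add]⟩
    | tmul p q =>
      refine ⟨φ q • p, fun a => ?_⟩
      have hs : ∀ w : A ⊗[ℂ] A, tensorFunctional φ φ w = φ (sliceRight φ w) := by
        intro w
        induction w with
        | zero => simp
        | add x y hx hy => simp only [map_add, hx, hy]
        | tmul a b => simp [mul_comm]
      rw [left_T₃, hs, hφ.2.1]
      simp [mul_smul_comm, mul_comm]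
  obtain ⟨d, hd⟩ := key (H.T₃.symm (c ⊗ₜ c'))
  refine ⟨d, ?_⟩
  ext a
  rw [convolution_apply]
  simpa [rightTranslate] using (hd a).symm

variable {H}

/-- The product of the dual `Â`: `⟨a, b b'⟩ = ⟨Δ(a), b ⊗ b'⟩`. Elements `c`, `c'` with
`b = φ(· c)` and `b' = φ(· c')` are chosen; the result does not depend on this choice, see
`dualMul_apply`. -/
def IsLeftIntegral.dualMul {φ : Module.Dual ℂ A} (hφ : H.IsLeftIntegral φ)
    (b b' : dualSpace φ) : dualSpace φ :=
  ⟨H.convolution φ b.2.choose b'.2.choose, H.convolution_mem hφ _ _⟩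

theorem IsLeftIntegral.dualMul_apply {φ : Module.Dual ℂ A} (hφ : H.IsLeftIntegral φ)
    (b b' : dualSpace φ) (c c' : A) (hc : (b : Module.Dual ℂ A) = rightTranslate φ c)
    (hc' : (b' : Module.Dual ℂ A) = rightTranslate φ c') (a : A) :
    (hφ.dualMul b b' : Module.Dual ℂ A) a
      = tensorFunctional φ φ (leftMul (H.Δ a) (c ⊗ₜ c')) := by
  have h := H.convolution_congr φ (b.2.choose_spec.trans hc) (b'.2.choose_spec.trans hc')
  exact congrArg (fun f : Module.Dual ℂ A => f a) h

theorem IsLeftIntegral.dualMul_tmul {φ : Module.Dual ℂ A} (hφ : H.IsLeftIntegral φ)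
    (b b' : dualSpace φ) (a c' : A) (hc' : (b' : Module.Dual ℂ A) = rightTranslate φ c') :
    (hφ.dualMul b b' : Module.Dual ℂ A) a
      = tensorFunctional (b : Module.Dual ℂ A) φ (H.T₁ (a ⊗ₜ c')) := by
  obtain ⟨c, hc⟩ := b.2
  rw [hφ.dualMul_apply b b' c c' hc.symm hc', ← hc, ← convolution_apply, convolution_eq_T₁]

theorem IsLeftIntegral.dualMul_tmul' {φ : Module.Dual ℂ A} (hφ : H.IsLeftIntegral φ)
    (b b' : dualSpace φ) (a c : A) (hc : (b : Module.Dual ℂ A) = rightTranslate φ c) :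
    (hφ.dualMul b b' : Module.Dual ℂ A) a
      = tensorFunctional φ (b' : Module.Dual ℂ A) (H.T₃ (a ⊗ₜ c)) := by
  obtain ⟨c', hc'⟩ := b'.2
  rw [hφ.dualMul_apply b b' c c' hc hc'.symm, ← hc', ← convolution_apply, convolution_eq_T₃]

/-- The product of the dual `Â`, as a linear map `Â ⊗ Â → Â`. -/
def IsLeftIntegral.dualMulTensor {φ : Module.Dual ℂ A} (hφ : H.IsLeftIntegral φ) :
    dualSpace φ ⊗[ℂ] dualSpace φ →ₗ[ℂ] dualSpace φ :=
  TensorProduct.lift (LinearMap.mk₂ ℂ hφ.dualMul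
    (fun b₁ b₂ b' => by
      obtain ⟨c', hc'⟩ := b'.2
      ext a
      simp only [Submodule.coe_add, LinearMap.add_apply, hφ.dualMul_tmul _ b' a c' hc'.symm]
      simp [tensorFunctional, TensorProduct.map_add_left])
    (fun r b b' => by
      obtain ⟨c', hc'⟩ := b'.2
      ext a
      simp only [Submodule.coe_smul, LinearMap.smul_apply, hφ.dualMul_tmul _ b' a c' hc'.symm]
      simp [tensorFunctional, TensorProduct.map_smul_left])
    (fun b b₁ b₂ => by
      obtain ⟨c, hc⟩ := b.2
      ext a
      simp only [Submodule.coe_add, LinearMap.add_apply, hφ.dualMul_tmul' b _ a c hc.symm]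
      simp [tensorFunctional, TensorProduct.map_add_right])
    (fun r b b' => by
      obtain ⟨c, hc⟩ := b.2
      ext a
      simp only [Submodule.coe_smul, LinearMap.smul_apply, hφ.dualMul_tmul' b _ a c hc.symm]
      simp [tensorFunctional, TensorProduct.map_smul_right]))

@[simp] theorem IsLeftIntegral.dualMulTensor_tmul {φ : Module.Dual ℂ A}
    (hφ : H.IsLeftIntegral φ) (b b' : dualSpace φ) :
    hφ.dualMulTensor (b ⊗ₜ b') = hφ.dualMul b b' := by
  simp [IsLeftIntegral.dualMulTensor]

/-- The pairing of `A ⊗ A` with `Â ⊗ Â`: `⟨a ⊗ a', b ⊗ b'⟩ = ⟨a, b⟩⟨a', b'⟩`. -/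
def tensorPairing (φ : Module.Dual ℂ A) :
    dualSpace φ ⊗[ℂ] dualSpace φ →ₗ[ℂ] Module.Dual ℂ (A ⊗[ℂ] A) :=
  TensorProduct.dualDistrib ℂ A A ∘ₗ
    TensorProduct.map (dualSpace φ).subtype (dualSpace φ).subtype

/-- `T` is the map `b ⊗ b' ↦ Δ(b)(1 ⊗ b')` on `Â ⊗ Â`, where the coproduct of `Â` is the adjoint
of the product of `A`:
`⟨a ⊗ a', Δ(b)(1 ⊗ b')⟩ = ⟨(a ⊗ 1)Δ(a'), b ⊗ b'⟩`. -/
def IsDualT₁ (H : RegularMultiplierHopfAlgebra A) (φ : Module.Dual ℂ A)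
    (T : dualSpace φ ⊗[ℂ] dualSpace φ →ₗ[ℂ] dualSpace φ ⊗[ℂ] dualSpace φ) : Prop :=
  ∀ (b b' : dualSpace φ) (a a' : A), tensorPairing φ (T (b ⊗ₜ b')) (a ⊗ₜ a') =
    tensorPairing φ (b ⊗ₜ b') (H.T₂ (a ⊗ₜ a'))

/-- `T` is the map `b ⊗ b' ↦ (b ⊗ 1)Δ(b')` on `Â ⊗ Â`:
`⟨a ⊗ a', (b ⊗ 1)Δ(b')⟩ = ⟨Δ(a)(1 ⊗ a'), b ⊗ b'⟩`. -/
def IsDualT₂ (H : RegularMultiplierHopfAlgebra A) (φ : Module.Dual ℂ A)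
    (T : dualSpace φ ⊗[ℂ] dualSpace φ →ₗ[ℂ] dualSpace φ ⊗[ℂ] dualSpace φ) : Prop :=
  ∀ (b b' : dualSpace φ) (a a' : A), tensorPairing φ (T (b ⊗ₜ b')) (a ⊗ₜ a') =
    tensorPairing φ (b ⊗ₜ b') (H.T₁ (a ⊗ₜ a'))

/-- `SB` is the antipode of the dual `Â`. In terms of the maps `T₁ : b ⊗ b' ↦ Δ(b)(1 ⊗ b')` and
`T₂ : b ⊗ b' ↦ (b ⊗ 1)Δ(b')` of `Â ⊗ Â` into itself, there is a counit `εB`, that is,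
`(εB ⊗ ι)(Δ(b)(1 ⊗ b')) = bb'` and `(ι ⊗ εB)((b ⊗ 1)Δ(b')) = bb'`, and
`m((SB ⊗ ι)(Δ(b)(1 ⊗ b'))) = εB(b)b'` and `m((ι ⊗ SB)((b ⊗ 1)Δ(b'))) = εB(b')b`. -/
def IsLeftIntegral.IsDualAntipode {φ : Module.Dual ℂ A} (hφ : H.IsLeftIntegral φ)
    (SB : dualSpace φ ≃ₗ[ℂ] dualSpace φ) : Prop :=
  ∃ (T₁ T₂ : dualSpace φ ⊗[ℂ] dualSpace φ →ₗ[ℂ] dualSpace φ ⊗[ℂ] dualSpace φ)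
    (εB : Module.Dual ℂ (dualSpace φ)),
    IsDualT₁ H φ T₁ ∧ IsDualT₂ H φ T₂ ∧
    (∀ b b' : dualSpace φ, sliceLeft εB (T₁ (b ⊗ₜ b')) = hφ.dualMul b b') ∧
    (∀ b b' : dualSpace φ, sliceRight εB (T₂ (b ⊗ₜ b')) = hφ.dualMul b b') ∧
    (∀ b b' : dualSpace φ, hφ.dualMulTensor
      (TensorProduct.map SB.toLinearMap LinearMap.id (T₁ (b ⊗ₜ b'))) = εB b • b') ∧
    (∀ b b' : dualSpace φ, hφ.dualMulTensor
      (TensorProduct.map LinearMap.id SB.toLinearMap (T₂ (b ⊗ₜ b'))) = εB b' • b)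

end RegularMultiplierHopfAlgebra

/-- The right integral `ψ = φ ∘ S` associated with the left integral `φ`. -/
def rightIntegral {A : Type*} [NonUnitalRing A] [Module ℂ A] (φ : Module.Dual ℂ A)
    (S : A ≃ₗ[ℂ] A) : Module.Dual ℂ A := φ ∘ₗ S.toLinearMap

end MHA

end

/-!
Coassociativity of `Δ` in terms of the bijections `T₁ : a ⊗ b ↦ Δ(a)(1 ⊗ b)` and
`T₂ : a ⊗ b ↦ (a ⊗ 1)Δ(b)` gives the counit: `x ⊗ m(T₁⁻¹(y ⊗ z)) = m(T₂⁻¹(x ⊗ y)) ⊗ z` forces both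
sides to be `ε(y) x ⊗ z`. For the antipode, every element of `A` has the form
`(ι ⊗ φ)(Δ(p)(1 ⊗ q))`, and `S` sends it to `(ι ⊗ φ)((1 ⊗ p)Δ(q))`; passing to the opposite algebra
yields `S⁻¹`. The integral `φ` is faithful, and the same holds for `ψ = φ ∘ S`, which is a left
integral for the opposite coproduct. Hence the Fourier transforms `F = φ(· a)`, `G = ψ(S(·)a)` and
`ψ(a ·)` are injective, and they have the same range `Â`.

Transported along these transforms, the coproduct of `Â` is obtained from the inverse of
`Δ(a)(b ⊗ 1)` (resp. `(1 ⊗ a)Δ(b)`) and the flip, so that the axioms for the antipode `b ↦ b ∘ S`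
of `Â` become the invariance of `φ` and `ψ`. Finally `S(F c) F a = F((φ ⊗ ι)(Δ(a)(c ⊗ 1)))` and
`F c G a = G((ι ⊗ φ)(Δ(a)(1 ⊗ c)))`. Applying `ε` in the remaining leg gives `φ(ac) = ⟨a, F c⟩` in
both cases, which are the two inversion formulas.
-/

noncomputable section

namespace MHA

open TensorProduct (assoc curry)
open LinearMap (rTensor lTensor)

section TensorLegs

variable {V V' W W' W'' : Type*} [AddCommGroup V] [Module ℂ V] [AddCommGroup V'] [Module ℂ V']
  [AddCommGroup W] [Module ℂ W] [AddCommGroup W'] [Module ℂ W'] [AddCommGroup W''] [Module ℂ W'']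

theorem apply_eq_apply_of_equiv_tmul (T : V ⊗[ℂ] W ≃ₗ[ℂ] W') {f g : W' →ₗ[ℂ] W''}
    (h : ∀ a b, f (T (a ⊗ₜ b)) = g (T (a ⊗ₜ b))) (z : W') : f z = g z := by
  have h' : f ∘ₗ T.toLinearMap = g ∘ₗ T.toLinearMap := TensorProduct.ext' h
  simpa using LinearMap.congr_fun h' (T.symm z)

theorem eq_of_forall_lTensor_eq {ι : Type*} (g : ι → W →ₗ[ℂ] W')
    (hg : ∀ w, (∀ i, g i w = 0) → w = 0) {z z' : V ⊗[ℂ] W}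
    (h : ∀ i, lTensor V (g i) z = lTensor V (g i) z') : z = z' := by
  classical
  let e := Module.Basis.ofVectorSpace ℂ V
  have coord_lTensor (i : ι) (k) (z : V ⊗[ℂ] W) :
      TensorProduct.equivFinsuppOfBasisLeft e (lTensor V (g i) z) k =
        g i (TensorProduct.equivFinsuppOfBasisLeft e z k) := by
    induction z with
    | zero => simp
    | add x y hx hy => simp only [map_add, Finsupp.add_apply, hx, hy]
    | tmul a b => simp [TensorProduct.equivFinsuppOfBasisLeft_apply_tmul]
  apply (TensorProduct.equivFinsuppOfBasisLeft (N := W) e).injective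
  ext k
  refine sub_eq_zero.1 (hg _ fun i => ?_)
  rw [map_sub, ← coord_lTensor, ← coord_lTensor, h, sub_self]

theorem eq_of_forall_rTensor_eq {ι : Type*} (g : ι → V →ₗ[ℂ] V')
    (hg : ∀ v, (∀ i, g i v = 0) → v = 0) {z z' : V ⊗[ℂ] W}
    (h : ∀ i, rTensor W (g i) z = rTensor W (g i) z') : z = z' := by
  refine (TensorProduct.comm ℂ V W).injective (eq_of_forall_lTensor_eq g hg fun i => ?_)
  rw [lTensor, TensorProduct.map_comm, TensorProduct.map_comm]
  exact congrArg _ (h i)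

theorem rTensor_lTensor (f : V →ₗ[ℂ] V') (g : W →ₗ[ℂ] W') (z : V ⊗[ℂ] W) :
    rTensor W' f (lTensor V g z) = lTensor V' g (rTensor W f z) := by
  rw [← LinearMap.comp_apply, ← LinearMap.comp_apply, LinearMap.rTensor_comp_lTensor,
    LinearMap.lTensor_comp_rTensor]

theorem rTensor_assoc (f : V →ₗ[ℂ] V') (z : (V ⊗[ℂ] W) ⊗[ℂ] W') :
    rTensor (W ⊗[ℂ] W') f (assoc ℂ V W W' z) = assoc ℂ V' W W' (rTensor W' (rTensor W f) z) := by
  simp [LinearMap.rTensor_tensor]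

theorem lTensor_rTensor_assoc (f : W →ₗ[ℂ] W') (z : (V ⊗[ℂ] W) ⊗[ℂ] V') :
    lTensor V (rTensor V' f) (assoc ℂ V W V' z) = assoc ℂ V W' V' (rTensor V' (lTensor V f) z) :=
  LinearMap.congr_fun (LinearMap.lTensor_rTensor_comp_assoc W f) z

theorem lTensor_lTensor_assoc (f : W' →ₗ[ℂ] V') (z : (V ⊗[ℂ] W) ⊗[ℂ] W') :
    lTensor V (lTensor W f) (assoc ℂ V W W' z) = assoc ℂ V W V' (lTensor (V ⊗[ℂ] W) f z) := by
  simp [LinearMap.lTensor_tensor]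

theorem lTensor_assoc_tmul (f : W ⊗[ℂ] W' →ₗ[ℂ] V') (z : V ⊗[ℂ] W) (c : W') :
    lTensor V f (assoc ℂ V W W' (z ⊗ₜ c)) = lTensor V ((curry f).flip c) z := by
  induction z with
  | zero => simp
  | add x y hx hy => simp only [map_add, TensorProduct.add_tmul, hx, hy]
  | tmul a b => simp

end TensorLegs

section SliceMaps

variable {V W : Type*} [AddCommGroup V] [Module ℂ V] [AddCommGroup W] [Module ℂ W]

theorem sliceLeft_map (ω : Module.Dual ℂ W) (f g : V →ₗ[ℂ] W) (z : V ⊗[ℂ] V) :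
    sliceLeft ω (TensorProduct.map f g z) = g (sliceLeft (ω ∘ₗ f) z) := by
  induction z <;> simp_all

theorem sliceRight_map (ω : Module.Dual ℂ W) (f g : V →ₗ[ℂ] W) (z : V ⊗[ℂ] V) :
    sliceRight ω (TensorProduct.map f g z) = f (sliceRight (ω ∘ₗ g) z) := by
  induction z <;> simp_all

theorem sliceLeft_lTensor (ω : Module.Dual ℂ V) (g : V →ₗ[ℂ] V) (z : V ⊗[ℂ] V) :
    sliceLeft ω (lTensor V g z) = g (sliceLeft ω z) :=
  sliceLeft_map ω _ g z

theorem sliceLeft_rTensor (ω : Module.Dual ℂ V) (f : V →ₗ[ℂ] V) (z : V ⊗[ℂ] V) :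
    sliceLeft ω (rTensor V f z) = sliceLeft (ω ∘ₗ f) z :=
  sliceLeft_map ω f _ z

theorem sliceRight_rTensor (ω : Module.Dual ℂ V) (f : V →ₗ[ℂ] V) (z : V ⊗[ℂ] V) :
    sliceRight ω (rTensor V f z) = f (sliceRight ω z) :=
  sliceRight_map ω f _ z

theorem sliceRight_lTensor (ω : Module.Dual ℂ V) (g : V →ₗ[ℂ] V) (z : V ⊗[ℂ] V) :
    sliceRight ω (lTensor V g z) = sliceRight (ω ∘ₗ g) z :=
  sliceRight_map ω _ g z

theorem sliceLeft_comm (ω : Module.Dual ℂ V) (z : V ⊗[ℂ] V) :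
    sliceLeft ω (TensorProduct.comm ℂ V V z) = sliceRight ω z := by
  induction z <;> simp_all

theorem sliceRight_comm (ω : Module.Dual ℂ V) (z : V ⊗[ℂ] V) :
    sliceRight ω (TensorProduct.comm ℂ V V z) = sliceLeft ω z := by
  induction z <;> simp_all

theorem apply_sliceLeft (ω ω' : Module.Dual ℂ V) (z : V ⊗[ℂ] V) :
    ω' (sliceLeft ω z) = ω (sliceRight ω' z) := by
  induction z <;> simp_all [mul_comm]

theorem lTensor_sliceLeft_assoc_tmul (ω : Module.Dual ℂ V) (z : V ⊗[ℂ] V) (c : V) :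
    lTensor V (sliceLeft ω) (assoc ℂ V V V (z ⊗ₜ c)) = sliceRight ω z ⊗ₜ c := by
  induction z <;> simp_all [TensorProduct.add_tmul, TensorProduct.smul_tmul]

theorem lTensor_sliceRight_assoc_tmul (ω : Module.Dual ℂ V) (z : V ⊗[ℂ] V) (c : V) :
    lTensor V (sliceRight ω) (assoc ℂ V V V (z ⊗ₜ c)) = ω c • z := by
  induction z <;> simp_all [TensorProduct.add_tmul]

theorem lTensor_sliceRight_assoc_rTensor (ω : Module.Dual ℂ V) (f : V →ₗ[ℂ] V ⊗[ℂ] V)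
    (z : V ⊗[ℂ] V) :
    lTensor V (sliceRight ω) (assoc ℂ V V V (rTensor V f z)) = f (sliceRight ω z) := by
  induction z <;> simp_all [lTensor_sliceRight_assoc_tmul]

theorem lTensor_toSpanSingleton_comp (ω : Module.Dual ℂ V) (b : V) (z : V ⊗[ℂ] V) :
    lTensor V (LinearMap.toSpanSingleton ℂ V b ∘ₗ ω) z = sliceRight ω z ⊗ₜ b := by
  induction z <;> simp_all [TensorProduct.add_tmul, TensorProduct.smul_tmul]

theorem lift_eq_zero_of_forall_sliceRight_eq_zero (g : V →ₗ[ℂ] Module.Dual ℂ V) {z : V ⊗[ℂ] V}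
    (h : ∀ x, sliceRight (g x) z = 0) : TensorProduct.lift g z = 0 := by
  have hz : lTensor V g.flip z = 0 := by
    refine eq_of_forall_lTensor_eq (fun x : V => (LinearMap.applyₗ x : Module.Dual ℂ V →ₗ[ℂ] ℂ))
      (fun w hw => LinearMap.ext hw) fun x => (TensorProduct.rid ℂ V).injective ?_
    rw [map_zero, map_zero, ← LinearMap.lTensor_comp_apply]
    exact h x
  have hlift : TensorProduct.lift g = TensorProduct.lift LinearMap.applyₗ ∘ₗ lTensor V g.flip :=
    TensorProduct.ext' fun a b => by simp
  rw [hlift, LinearMap.comp_apply, hz, map_zero]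

theorem sliceRight_surjective {ω : Module.Dual ℂ V} (hω : ω ≠ 0) :
    Function.Surjective (sliceRight ω) := fun a => by
  obtain ⟨v, hv⟩ := LinearMap.surjective hω 1
  exact ⟨a ⊗ₜ v, by simp [hv]⟩

theorem sliceLeft_surjective {ω : Module.Dual ℂ V} (hω : ω ≠ 0) :
    Function.Surjective (sliceLeft ω) := fun a => by
  obtain ⟨v, hv⟩ := LinearMap.surjective hω 1
  exact ⟨v ⊗ₜ a, by simp [hv]⟩

theorem sliceLeft_injective : Function.Injective (sliceLeft (V := V)) := fun ω ω' h => by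
  rcases subsingleton_or_nontrivial V with _ | _
  · exact Subsingleton.elim _ _
  obtain ⟨u, hu⟩ := exists_ne (0 : V)
  ext a
  simpa [hu] using LinearMap.congr_fun h (a ⊗ₜ u)

theorem exists_dual_eq_sliceLeft_eq_sliceRight (f g : V ⊗[ℂ] V →ₗ[ℂ] V)
    (h : ∀ x y z, x ⊗ₜ f (y ⊗ₜ z) = g (x ⊗ₜ y) ⊗ₜ[ℂ] z) :
    ∃ ω : Module.Dual ℂ V, sliceLeft ω = f ∧ sliceRight ω = g := by
  rcases subsingleton_or_nontrivial V with _ | _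
  · exact ⟨0, Subsingleton.elim _ _, Subsingleton.elim _ _⟩
  obtain ⟨u, hu⟩ := exists_ne (0 : V)
  obtain ⟨ω, hω⟩ := Module.Projective.exists_dual_eq_one ℂ hu
  have hf (y z : V) : f (y ⊗ₜ z) = ω (g (u ⊗ₜ y)) • z := by
    simpa [hω] using congrArg (sliceLeft ω) (h u y z)
  have hg (x y : V) : g (x ⊗ₜ y) = ω (g (u ⊗ₜ y)) • x := by
    simpa [hω, hf] using (congrArg (sliceRight ω) (h x y u)).symm
  exact ⟨ω ∘ₗ curry g u, TensorProduct.ext' fun y z => by simp [hf y z],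
    TensorProduct.ext' fun x y => by simp [hg x y]⟩

end SliceMaps

section Reversal

variable {V : Type*} [AddCommGroup V] [Module ℂ V]

/-- The map `a ⊗ (b ⊗ c) ↦ c ⊗ (b ⊗ a)`, which exchanges the two sides of coassociativity when the
coproduct is replaced by the opposite one. -/
def reverseLegs (V : Type*) [AddCommGroup V] [Module ℂ V] :
    V ⊗[ℂ] (V ⊗[ℂ] V) →ₗ[ℂ] V ⊗[ℂ] (V ⊗[ℂ] V) :=
  (assoc ℂ V V V).toLinearMap ∘ₗ (TensorProduct.comm ℂ V (V ⊗[ℂ] V)).toLinearMap ∘ₗ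
    lTensor V (TensorProduct.comm ℂ V V).toLinearMap

@[simp] theorem reverseLegs_tmul (a b c : V) :
    reverseLegs V (a ⊗ₜ (b ⊗ₜ c)) = c ⊗ₜ (b ⊗ₜ a) := by
  simp [reverseLegs]

theorem assoc_rTensor_comm (g : V →ₗ[ℂ] V ⊗[ℂ] V) (y : V ⊗[ℂ] V) :
    assoc ℂ V V V (rTensor V ((TensorProduct.comm ℂ V V).toLinearMap ∘ₗ g)
      (TensorProduct.comm ℂ V V y)) = reverseLegs V (lTensor V g y) := by
  induction y with
  | zero => simp
  | add x y hx hy => simp only [map_add, hx, hy]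
  | tmul a b =>
    simp only [TensorProduct.comm_tmul, LinearMap.rTensor_tmul, LinearMap.lTensor_tmul,
      LinearMap.comp_apply, LinearEquiv.coe_coe]
    induction g b <;> simp_all [TensorProduct.add_tmul, TensorProduct.tmul_add]

theorem lTensor_comm_comp (f : V →ₗ[ℂ] V ⊗[ℂ] V) (x : V ⊗[ℂ] V) :
    lTensor V ((TensorProduct.comm ℂ V V).toLinearMap ∘ₗ f) (TensorProduct.comm ℂ V V x) =
      reverseLegs V (assoc ℂ V V V (rTensor V f x)) := by
  induction x with
  | zero => simp
  | add x y hx hy => simp only [map_add, hx, hy]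
  | tmul a b =>
    simp only [TensorProduct.comm_tmul, LinearMap.rTensor_tmul, LinearMap.lTensor_tmul,
      LinearMap.comp_apply, LinearEquiv.coe_coe]
    induction f a <;> simp_all [TensorProduct.add_tmul, TensorProduct.tmul_add]

theorem assoc_rTensor_comm_eq_lTensor_comm {f g : V →ₗ[ℂ] V ⊗[ℂ] V} {x y : V ⊗[ℂ] V}
    (h : assoc ℂ V V V (rTensor V f x) = lTensor V g y) :
    assoc ℂ V V V (rTensor V ((TensorProduct.comm ℂ V V).toLinearMap ∘ₗ g)
      (TensorProduct.comm ℂ V V y)) =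
    lTensor V ((TensorProduct.comm ℂ V V).toLinearMap ∘ₗ f) (TensorProduct.comm ℂ V V x) := by
  rw [assoc_rTensor_comm, lTensor_comm_comp, h]

end Reversal

/-- A regular multiplier Hopf algebra presented by linear maps: the product `m`, the maps
`T₁ (a ⊗ b) = Δ(a)(1 ⊗ b)`, `T₂ (a ⊗ b) = (a ⊗ 1)Δ(b)`, `T₃ (a ⊗ b) = Δ(a)(b ⊗ 1)`,
`T₄ (a ⊗ b) = (1 ⊗ a)Δ(b)`, and the actions `leftΔ a z = Δ(a)z`, `rightΔ a z = zΔ(a)`.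
Since `m` is a field rather than an instance, passing to the opposite product or the opposite
coproduct stays on the same space and gives each statement its mirror images. -/
structure HopfData (V : Type*) [AddCommGroup V] [Module ℂ V] where
  m : V →ₗ[ℂ] V →ₗ[ℂ] V
  m_assoc : ∀ a b c, m (m a b) c = m a (m b c)
  eq_zero_of_m_right : ∀ a, (∀ b, m a b = 0) → a = 0
  eq_zero_of_m_left : ∀ b, (∀ a, m a b = 0) → b = 0
  T₁ : V ⊗[ℂ] V ≃ₗ[ℂ] V ⊗[ℂ] V
  T₂ : V ⊗[ℂ] V ≃ₗ[ℂ] V ⊗[ℂ] V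
  T₃ : V ⊗[ℂ] V ≃ₗ[ℂ] V ⊗[ℂ] V
  T₄ : V ⊗[ℂ] V ≃ₗ[ℂ] V ⊗[ℂ] V
  leftΔ : V →ₗ[ℂ] V ⊗[ℂ] V →ₗ[ℂ] V ⊗[ℂ] V
  rightΔ : V →ₗ[ℂ] V ⊗[ℂ] V →ₗ[ℂ] V ⊗[ℂ] V
  leftΔ_tmul_eq_T₁ : ∀ a x y, leftΔ a (x ⊗ₜ y) = rTensor V (m.flip x) (T₁ (a ⊗ₜ y))
  leftΔ_tmul_eq_T₃ : ∀ a x y, leftΔ a (x ⊗ₜ y) = lTensor V (m.flip y) (T₃ (a ⊗ₜ x))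
  rightΔ_tmul_eq_T₂ : ∀ a x y, rightΔ a (x ⊗ₜ y) = lTensor V (m y) (T₂ (x ⊗ₜ a))
  rightΔ_tmul_eq_T₄ : ∀ a x y, rightΔ a (x ⊗ₜ y) = rTensor V (m x) (T₄ (y ⊗ₜ a))
  leftΔ_T₁ : ∀ a b c, leftΔ a (T₁ (b ⊗ₜ c)) = T₁ (m a b ⊗ₜ c)
  leftΔ_T₃ : ∀ a b c, leftΔ a (T₃ (b ⊗ₜ c)) = T₃ (m a b ⊗ₜ c)
  rightΔ_T₂ : ∀ a b c, rightΔ a (T₂ (b ⊗ₜ c)) = T₂ (b ⊗ₜ m c a)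
  rightΔ_T₄ : ∀ a b c, rightΔ a (T₄ (b ⊗ₜ c)) = T₄ (b ⊗ₜ m c a)
  T₁_T₂ : ∀ a b c, rTensor V (m a) (T₁ (b ⊗ₜ c)) = lTensor V (m.flip c) (T₂ (a ⊗ₜ b))
  T₃_T₄ : ∀ a b c, lTensor V (m a) (T₃ (b ⊗ₜ c)) = rTensor V (m.flip c) (T₄ (a ⊗ₜ b))
  T₃_T₂ : ∀ a b c, rTensor V (m a) (T₃ (b ⊗ₜ c)) = rTensor V (m.flip c) (T₂ (a ⊗ₜ b))
  T₁_T₄ : ∀ a b c, lTensor V (m a) (T₁ (b ⊗ₜ c)) = lTensor V (m.flip c) (T₄ (a ⊗ₜ b))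
  coassoc₂₁ : ∀ a b c, assoc ℂ V V V (rTensor V (curry T₂.toLinearMap a) (T₁ (b ⊗ₜ c))) =
    lTensor V ((curry T₁.toLinearMap).flip c) (T₂ (a ⊗ₜ b))
  coassoc₃₄ : ∀ a b c, assoc ℂ V V V (rTensor V ((curry T₃.toLinearMap).flip a) (T₄ (c ⊗ₜ b))) =
    lTensor V (curry T₄.toLinearMap c) (T₃ (b ⊗ₜ a))

namespace HopfData

variable {V : Type*} [AddCommGroup V] [Module ℂ V]

section Mirror

variable (H : HopfData V)

/-- The same coproduct on the opposite algebra. -/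
def op : HopfData V where
  m := H.m.flip
  m_assoc a b c := (H.m_assoc c b a).symm
  eq_zero_of_m_right := H.eq_zero_of_m_left
  eq_zero_of_m_left := H.eq_zero_of_m_right
  T₁ := TensorProduct.comm ℂ V V ≪≫ₗ H.T₄
  T₂ := TensorProduct.comm ℂ V V ≪≫ₗ H.T₃
  T₃ := TensorProduct.comm ℂ V V ≪≫ₗ H.T₂
  T₄ := TensorProduct.comm ℂ V V ≪≫ₗ H.T₁
  leftΔ := H.rightΔ
  rightΔ := H.leftΔ
  leftΔ_tmul_eq_T₁ := H.rightΔ_tmul_eq_T₄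
  leftΔ_tmul_eq_T₃ := H.rightΔ_tmul_eq_T₂
  rightΔ_tmul_eq_T₂ := H.leftΔ_tmul_eq_T₃
  rightΔ_tmul_eq_T₄ := H.leftΔ_tmul_eq_T₁
  leftΔ_T₁ a b c := H.rightΔ_T₄ a c b
  leftΔ_T₃ a b c := H.rightΔ_T₂ a c b
  rightΔ_T₂ a b c := H.leftΔ_T₃ a c b
  rightΔ_T₄ a b c := H.leftΔ_T₁ a c b
  T₁_T₂ a b c := (H.T₃_T₄ c b a).symm
  T₃_T₄ a b c := (H.T₁_T₂ c b a).symm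
  T₃_T₂ a b c := (H.T₃_T₂ c b a).symm
  T₁_T₄ a b c := (H.T₁_T₄ c b a).symm
  coassoc₂₁ a b c := H.coassoc₃₄ a b c
  coassoc₃₄ a b c := H.coassoc₂₁ a b c

/-- The opposite algebra with the opposite coproduct. -/
def opCoop : HopfData V where
  m := H.m.flip
  m_assoc a b c := (H.m_assoc c b a).symm
  eq_zero_of_m_right := H.eq_zero_of_m_left
  eq_zero_of_m_left := H.eq_zero_of_m_right
  T₁ := TensorProduct.comm ℂ V V ≪≫ₗ H.T₂ ≪≫ₗ TensorProduct.comm ℂ V V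
  T₂ := TensorProduct.comm ℂ V V ≪≫ₗ H.T₁ ≪≫ₗ TensorProduct.comm ℂ V V
  T₃ := TensorProduct.comm ℂ V V ≪≫ₗ H.T₄ ≪≫ₗ TensorProduct.comm ℂ V V
  T₄ := TensorProduct.comm ℂ V V ≪≫ₗ H.T₃ ≪≫ₗ TensorProduct.comm ℂ V V
  leftΔ := (TensorProduct.comm ℂ V V).conj.toLinearMap ∘ₗ H.rightΔ
  rightΔ := (TensorProduct.comm ℂ V V).conj.toLinearMap ∘ₗ H.leftΔ
  leftΔ_tmul_eq_T₁ a x y := by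
    simp [LinearEquiv.conj_apply, H.rightΔ_tmul_eq_T₂, rTensor, lTensor, TensorProduct.map_comm]
  leftΔ_tmul_eq_T₃ a x y := by
    simp [LinearEquiv.conj_apply, H.rightΔ_tmul_eq_T₄, rTensor, lTensor, TensorProduct.map_comm]
  rightΔ_tmul_eq_T₂ a x y := by
    simp [LinearEquiv.conj_apply, H.leftΔ_tmul_eq_T₁, rTensor, lTensor, TensorProduct.map_comm]
  rightΔ_tmul_eq_T₄ a x y := by
    simp [LinearEquiv.conj_apply, H.leftΔ_tmul_eq_T₃, rTensor, lTensor, TensorProduct.map_comm]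
  leftΔ_T₁ a b c := by simp [LinearEquiv.conj_apply, H.rightΔ_T₂]
  leftΔ_T₃ a b c := by simp [LinearEquiv.conj_apply, H.rightΔ_T₄]
  rightΔ_T₂ a b c := by simp [LinearEquiv.conj_apply, H.leftΔ_T₁]
  rightΔ_T₄ a b c := by simp [LinearEquiv.conj_apply, H.leftΔ_T₃]
  T₁_T₂ a b c := by
    simpa [rTensor, lTensor, TensorProduct.map_comm] using (H.T₁_T₂ c b a).symm
  T₃_T₄ a b c := by
    simpa [rTensor, lTensor, TensorProduct.map_comm] using (H.T₃_T₄ c b a).symm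
  T₃_T₂ a b c := by
    simpa [rTensor, lTensor, TensorProduct.map_comm] using (H.T₁_T₄ c b a).symm
  T₁_T₄ a b c := by
    simpa [rTensor, lTensor, TensorProduct.map_comm] using (H.T₃_T₂ c b a).symm
  coassoc₂₁ a b c :=
    assoc_rTensor_comm_eq_lTensor_comm (f := curry H.T₂.toLinearMap c)
      (g := (curry H.T₁.toLinearMap).flip a) (x := H.T₁ (b ⊗ₜ a)) (y := H.T₂ (c ⊗ₜ b))
      (H.coassoc₂₁ c b a)
  coassoc₃₄ a b c :=
    assoc_rTensor_comm_eq_lTensor_comm (f := (curry H.T₃.toLinearMap).flip c)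
      (g := curry H.T₄.toLinearMap a) (x := H.T₄ (a ⊗ₜ b)) (y := H.T₃ (b ⊗ₜ c))
      (H.coassoc₃₄ c b a)

end Mirror

section CoverLeft

variable (H : HopfData V)

/-- The map `b ⊗ c ↦ (a ⊗ 1)Δ(b) ⊗ c`. It writes the left-hand side of coassociativity without
leaving `A ⊗ A ⊗ A`. -/
def coverLeft (a : V) : V ⊗[ℂ] V →ₗ[ℂ] V ⊗[ℂ] (V ⊗[ℂ] V) :=
  (assoc ℂ V V V).toLinearMap ∘ₗ rTensor V (curry H.T₂.toLinearMap a)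

theorem lTensor_coverLeft_tmul {X : Type*} [AddCommGroup X] [Module ℂ X]
    (f : V ⊗[ℂ] V →ₗ[ℂ] X) (a b c : V) :
    lTensor V f (H.coverLeft a (b ⊗ₜ c)) = lTensor V ((curry f).flip c) (H.T₂ (a ⊗ₜ b)) :=
  lTensor_assoc_tmul f _ c

theorem coverLeft_T₁ (a : V) (w : V ⊗[ℂ] V) :
    H.coverLeft a (H.T₁ w) = lTensor V H.T₁.toLinearMap (H.coverLeft a w) := by
  have h : H.coverLeft a ∘ₗ H.T₁.toLinearMap = lTensor V H.T₁.toLinearMap ∘ₗ H.coverLeft a :=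
    TensorProduct.ext' fun b c =>
      (H.coassoc₂₁ a b c).trans (H.lTensor_coverLeft_tmul H.T₁.toLinearMap a b c).symm
  exact LinearMap.congr_fun h w

theorem lTensor_T₁_symm_coverLeft (a : V) (z : V ⊗[ℂ] V) :
    lTensor V H.T₁.symm.toLinearMap (H.coverLeft a z) = H.coverLeft a (H.T₁.symm z) := by
  obtain ⟨w, rfl⟩ := H.T₁.surjective z
  rw [coverLeft_T₁, ← LinearMap.lTensor_comp_apply]
  simp

theorem lTensor_lift_coverLeft (a : V) (w : V ⊗[ℂ] V) :
    lTensor V (TensorProduct.lift H.m) (H.coverLeft a w) = rTensor V (H.m a) (H.T₁ w) := by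
  have h : lTensor V (TensorProduct.lift H.m) ∘ₗ H.coverLeft a =
      rTensor V (H.m a) ∘ₗ H.T₁.toLinearMap :=
    TensorProduct.ext' fun b c =>
      (H.lTensor_coverLeft_tmul (TensorProduct.lift H.m) a b c).trans (H.T₁_T₂ a b c).symm
  exact LinearMap.congr_fun h w

end CoverLeft

/-- `ε` is a counit: `(ε ⊗ ι)(Δ(a)(1 ⊗ b)) = ab` and `(ι ⊗ ε)((a ⊗ 1)Δ(b)) = ab`. Multiplicativity
of `ε` is a consequence, see `IsCounit.map_m`. -/
structure IsCounit (H : HopfData V) (ε : Module.Dual ℂ V) : Prop where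
  sliceLeft_T₁ : ∀ a b, sliceLeft ε (H.T₁ (a ⊗ₜ b)) = H.m a b
  sliceRight_T₂ : ∀ a b, sliceRight ε (H.T₂ (a ⊗ₜ b)) = H.m a b

theorem tmul_lift_T₁_symm (H : HopfData V) (x y z : V) :
    x ⊗ₜ TensorProduct.lift H.m (H.T₁.symm (y ⊗ₜ z)) =
      TensorProduct.lift H.m (H.T₂.symm (x ⊗ₜ y)) ⊗ₜ[ℂ] z := by
  let E : V ⊗[ℂ] V →ₗ[ℂ] V := TensorProduct.lift H.m ∘ₗ H.T₁.symm.toLinearMap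
  refine apply_eq_apply_of_equiv_tmul H.T₂ (f := lTensor V ((curry E).flip z))
    (g := (TensorProduct.mk ℂ V V).flip z ∘ₗ TensorProduct.lift H.m ∘ₗ H.T₂.symm.toLinearMap)
    (fun a b => ?_) (x ⊗ₜ y)
  rw [← lTensor_coverLeft_tmul, LinearMap.lTensor_comp_apply, lTensor_T₁_symm_coverLeft,
    lTensor_lift_coverLeft]
  simp

theorem exists_isCounit (H : HopfData V) : ∃ ε, H.IsCounit ε := by
  obtain ⟨ε, hleft, hright⟩ := exists_dual_eq_sliceLeft_eq_sliceRight
    (TensorProduct.lift H.m ∘ₗ H.T₁.symm.toLinearMap)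
    (TensorProduct.lift H.m ∘ₗ H.T₂.symm.toLinearMap) H.tmul_lift_T₁_symm
  exact ⟨ε, fun a b => by simp [hleft], fun a b => by simp [hright]⟩

variable {H : HopfData V} {ε : Module.Dual ℂ V}

theorem eq_of_m_left_eq {x y : V} (h : ∀ b, H.m x b = H.m y b) : x = y :=
  sub_eq_zero.1 (H.eq_zero_of_m_right _ fun b => by rw [map_sub, LinearMap.sub_apply, h, sub_self])

namespace IsCounit

theorem opCoop (hε : H.IsCounit ε) : H.opCoop.IsCounit ε where
  sliceLeft_T₁ a b := by simp [HopfData.opCoop, sliceLeft_comm, hε.sliceRight_T₂]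
  sliceRight_T₂ a b := by simp [HopfData.opCoop, sliceRight_comm, hε.sliceLeft_T₁]

theorem ne_zero [Nontrivial V] (hε : H.IsCounit ε) : ε ≠ 0 := by
  rintro rfl
  obtain ⟨u, hu⟩ := exists_ne (0 : V)
  refine hu (H.eq_zero_of_m_right u fun b => ?_)
  rw [← hε.sliceLeft_T₁]
  simp [sliceLeft]

theorem eq_of_sliceLeft_T₁ (hε : H.IsCounit ε) {ε' : Module.Dual ℂ V}
    (h : ∀ a b, sliceLeft ε' (H.T₁ (a ⊗ₜ b)) = H.m a b) : ε' = ε :=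
  sliceLeft_injective <| LinearMap.ext <| apply_eq_apply_of_equiv_tmul H.T₁ fun a b => by
    rw [h, hε.sliceLeft_T₁]

theorem lift_T₁_symm (hε : H.IsCounit ε) (z : V ⊗[ℂ] V) :
    TensorProduct.lift H.m (H.T₁.symm z) = sliceLeft ε z :=
  apply_eq_apply_of_equiv_tmul H.T₁ (f := TensorProduct.lift H.m ∘ₗ H.T₁.symm.toLinearMap)
    (fun a b => by simp [hε.sliceLeft_T₁]) z

theorem sliceLeft_leftΔ (hε : H.IsCounit ε) (a : V) (z : V ⊗[ℂ] V) :
    sliceLeft ε (H.leftΔ a z) = H.m a (sliceLeft ε z) :=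
  apply_eq_apply_of_equiv_tmul H.T₁ (f := sliceLeft ε ∘ₗ H.leftΔ a) (g := H.m a ∘ₗ sliceLeft ε)
    (fun b c => by simp [H.leftΔ_T₁, hε.sliceLeft_T₁, H.m_assoc]) z

theorem comp_m_flip (hε : H.IsCounit ε) (c : V) : ε ∘ₗ H.m.flip c = ε c • ε := by
  refine sliceLeft_injective <| LinearMap.ext <| apply_eq_apply_of_equiv_tmul H.T₁ fun p q => ?_
  rw [← sliceLeft_rTensor, ← H.leftΔ_tmul_eq_T₁, hε.sliceLeft_leftΔ, sliceLeft_tmul, map_smul,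
    ← hε.sliceLeft_T₁]
  simp [sliceLeft, TensorProduct.map_smul_left]

theorem map_m (hε : H.IsCounit ε) (a b : V) : ε (H.m a b) = ε a * ε b := by
  simpa [mul_comm] using LinearMap.congr_fun (hε.comp_m_flip b) a

theorem sliceLeft_T₃ (hε : H.IsCounit ε) (a x : V) : sliceLeft ε (H.T₃ (a ⊗ₜ x)) = ε x • a :=
  eq_of_m_left_eq (H := H) fun y => by
    have := hε.sliceLeft_leftΔ a (x ⊗ₜ y)
    rw [H.leftΔ_tmul_eq_T₃, sliceLeft_lTensor] at this
    simpa using this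

theorem sliceLeft_T₄ (hε : H.IsCounit ε) (a b : V) : sliceLeft ε (H.T₄ (a ⊗ₜ b)) = H.m a b := by
  rcases subsingleton_or_nontrivial V with _ | _
  · exact Subsingleton.elim _ _
  obtain ⟨c, hc⟩ := LinearMap.surjective hε.ne_zero 1
  have := congrArg (sliceLeft ε) (H.T₃_T₄ a b c)
  rw [sliceLeft_lTensor, hε.sliceLeft_T₃, sliceLeft_rTensor, hε.comp_m_flip, hc, one_smul,
    one_smul] at this
  exact this.symm

theorem sliceRight_T₃ (hε : H.IsCounit ε) (a b : V) : sliceRight ε (H.T₃ (a ⊗ₜ b)) = H.m a b := by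
  simpa [HopfData.opCoop, sliceLeft_comm] using hε.opCoop.sliceLeft_T₄ b a

theorem op (hε : H.IsCounit ε) : H.op.IsCounit ε where
  sliceLeft_T₁ a b := hε.sliceLeft_T₄ b a
  sliceRight_T₂ a b := hε.sliceRight_T₃ b a

theorem sliceRight_T₁ (hε : H.IsCounit ε) (a x : V) : sliceRight ε (H.T₁ (a ⊗ₜ x)) = ε x • a := by
  simpa [HopfData.opCoop, HopfData.op, sliceLeft_comm] using hε.op.opCoop.sliceLeft_T₃ a x

end IsCounit

section IteratedCoproduct

variable (H : HopfData V)

/-- The map `x ⊗ y ↦ (Δ ⊗ ι)(Δ(p))(1 ⊗ x ⊗ y)`. -/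
def iteratedMap (p : V) : V ⊗[ℂ] V →ₗ[ℂ] V ⊗[ℂ] (V ⊗[ℂ] V) :=
  (assoc ℂ V V V).toLinearMap ∘ₗ
    rTensor V (H.T₁.toLinearMap ∘ₗ (TensorProduct.comm ℂ V V).toLinearMap) ∘ₗ
      (assoc ℂ V V V).symm.toLinearMap ∘ₗ lTensor V (curry H.T₁.toLinearMap p)

theorem iteratedMap_tmul (p x y : V) : H.iteratedMap p (x ⊗ₜ y) =
    assoc ℂ V V V (rTensor V ((curry H.T₁.toLinearMap).flip x) (H.T₁ (p ⊗ₜ y))) := by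
  simp only [iteratedMap, LinearMap.comp_apply, LinearMap.lTensor_tmul, LinearEquiv.coe_coe,
    TensorProduct.curry_apply, EmbeddingLike.apply_eq_iff_eq]
  induction H.T₁ (p ⊗ₜ y) <;> simp_all [TensorProduct.tmul_add]

theorem rTensor_iteratedMap (d p : V) (z : V ⊗[ℂ] V) :
    rTensor (V ⊗[ℂ] V) (H.m d) (H.iteratedMap p z) =
      lTensor V (H.leftΔ.flip z) (H.T₂ (d ⊗ₜ p)) := by
  induction z with
  | zero => simp
  | add x y hx hy => simp only [map_add, hx, hy, LinearMap.lTensor_add, LinearMap.add_apply]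
  | tmul x y =>
    have h₁ : rTensor V (H.m d) ∘ₗ (curry H.T₁.toLinearMap).flip x =
        lTensor V (H.m.flip x) ∘ₗ curry H.T₂.toLinearMap d :=
      LinearMap.ext fun r => H.T₁_T₂ d r x
    have h₂ : rTensor V (H.m.flip x) ∘ₗ (curry H.T₁.toLinearMap).flip y =
        H.leftΔ.flip (x ⊗ₜ y) :=
      LinearMap.ext fun r => (H.leftΔ_tmul_eq_T₁ r x y).symm
    rw [iteratedMap_tmul, rTensor_assoc, ← LinearMap.rTensor_comp_apply, h₁,
      LinearMap.rTensor_comp_apply, ← lTensor_rTensor_assoc, H.coassoc₂₁,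
      ← LinearMap.lTensor_comp_apply, h₂]

/-- Coassociativity in the form
`(Δ ⊗ ι)(Δ(p))(1 ⊗ Δ(q)(b ⊗ 1)) = (ι ⊗ Δ)(Δ(p)(1 ⊗ q))(1 ⊗ b ⊗ 1)`. -/
theorem iteratedMap_T₃ (p q b : V) : H.iteratedMap p (H.T₃ (q ⊗ₜ b)) =
    lTensor V ((curry H.T₃.toLinearMap).flip b) (H.T₁ (p ⊗ₜ q)) := by
  have h : H.leftΔ.flip (H.T₃ (q ⊗ₜ b)) = (curry H.T₃.toLinearMap).flip b ∘ₗ H.m.flip q :=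
    LinearMap.ext fun a => H.leftΔ_T₃ a q b
  refine eq_of_forall_rTensor_eq H.m H.eq_zero_of_m_left fun d => ?_
  rw [rTensor_iteratedMap, h, LinearMap.lTensor_comp_apply, ← H.T₁_T₂, rTensor_lTensor]

end IteratedCoproduct

/-- `φ` is a left integral: it is non-zero and `(ι ⊗ φ)Δ(a) = φ(a)1`, covered on the right and on
the left. -/
structure IsIntegral (H : HopfData V) (φ : Module.Dual ℂ V) : Prop where
  ne_zero : φ ≠ 0
  sliceRight_T₃ : ∀ a b, sliceRight φ (H.T₃ (a ⊗ₜ b)) = φ a • b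
  sliceRight_T₂ : ∀ a b, sliceRight φ (H.T₂ (a ⊗ₜ b)) = φ b • a

/-- `S` is an antipode with respect to the counit `ε`: `m(S ⊗ ι)(Δ(a)(1 ⊗ b)) = ε(a)b`. The other
law is a consequence, see `IsAntipode.lift_lTensor_T₂`. -/
structure IsAntipode (H : HopfData V) (ε : Module.Dual ℂ V) (S : V →ₗ[ℂ] V) : Prop where
  isCounit : H.IsCounit ε
  lift_rTensor_T₁ : ∀ a b, TensorProduct.lift H.m (rTensor V S (H.T₁ (a ⊗ₜ b))) = ε a • b

variable {H : HopfData V} {φ ε : Module.Dual ℂ V}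

theorem lTensor_sliceRight_iteratedMap_tmul (φ : Module.Dual ℂ V) (p x y : V) :
    lTensor V (sliceRight φ) (H.iteratedMap p (x ⊗ₜ y)) =
      H.T₁ (sliceRight φ (H.T₁ (p ⊗ₜ y)) ⊗ₜ x) := by
  rw [iteratedMap_tmul, lTensor_sliceRight_assoc_rTensor]
  simp

theorem IsCounit.sliceLeft_T₁_symm_iteratedMap (hε : H.IsCounit ε) (φ : Module.Dual ℂ V)
    (p : V) (z : V ⊗[ℂ] V) :
    sliceLeft ε (H.T₁.symm (lTensor V (sliceRight φ) (H.iteratedMap p z))) =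
      sliceRight (φ ∘ₗ H.m p) z := by
  induction z with
  | zero => simp
  | add x y hx hy => simp only [map_add, hx, hy]
  | tmul x y =>
    simp [lTensor_sliceRight_iteratedMap_tmul, ← apply_sliceLeft, hε.sliceLeft_T₁]

namespace IsIntegral

theorem op (hφ : H.IsIntegral φ) : H.op.IsIntegral φ where
  ne_zero := hφ.ne_zero
  sliceRight_T₃ a b := hφ.sliceRight_T₂ b a
  sliceRight_T₂ a b := hφ.sliceRight_T₃ b a

theorem lTensor_sliceRight_iteratedMap_T₃ (hφ : H.IsIntegral φ) (p q b : V) :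
    lTensor V (sliceRight φ) (H.iteratedMap p (H.T₃ (q ⊗ₜ b))) =
      sliceRight φ (H.T₁ (p ⊗ₜ q)) ⊗ₜ b := by
  have h : sliceRight φ ∘ₗ (curry H.T₃.toLinearMap).flip b = LinearMap.toSpanSingleton ℂ V b ∘ₗ φ :=
    LinearMap.ext fun r => hφ.sliceRight_T₃ r b
  rw [iteratedMap_T₃, ← LinearMap.lTensor_comp_apply, h, lTensor_toSpanSingleton_comp]

/-- This formula exhibits `(ι ⊗ φ)((1 ⊗ p)Δ(q))` as the antipode of `(ι ⊗ φ)(Δ(p)(1 ⊗ q))`: it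
evaluates the counit law for `T₁` on `iteratedMap p (Δ(q)(b ⊗ 1))` in two ways. -/
theorem sliceLeft_T₁_symm (hφ : H.IsIntegral φ) (hε : H.IsCounit ε) (z : V ⊗[ℂ] V) (b : V) :
    sliceLeft ε (H.T₁.symm (sliceRight φ (H.T₁ z) ⊗ₜ b)) = H.m (sliceRight φ (H.T₄ z)) b := by
  induction z with
  | zero => simp
  | add x y hx hy => simp only [map_add, TensorProduct.add_tmul, LinearMap.add_apply, hx, hy]
  | tmul p q =>
    rw [← hφ.lTensor_sliceRight_iteratedMap_T₃, hε.sliceLeft_T₁_symm_iteratedMap,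
      ← sliceRight_lTensor, H.T₃_T₄, sliceRight_rTensor, LinearMap.flip_apply]

end IsIntegral

variable {S : V →ₗ[ℂ] V}

theorem IsCounit.isAntipode_iff (hε : H.IsCounit ε) :
    H.IsAntipode ε S ↔ ∀ a b, sliceLeft ε (H.T₁.symm (a ⊗ₜ b)) = H.m (S a) b := by
  refine ⟨fun hS a b => ?_, fun h => ⟨hε, fun a b => ?_⟩⟩
  · exact apply_eq_apply_of_equiv_tmul H.T₁ (f := sliceLeft ε ∘ₗ H.T₁.symm.toLinearMap)
      (g := TensorProduct.lift H.m ∘ₗ rTensor V S)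
      (fun p q => by simp [hS.lift_rTensor_T₁ p q]) (a ⊗ₜ b)
  · have e : TensorProduct.lift H.m ∘ₗ rTensor V S = sliceLeft ε ∘ₗ H.T₁.symm.toLinearMap :=
      TensorProduct.ext' fun a b => by simp [h]
    simpa using LinearMap.congr_fun e (H.T₁ (a ⊗ₜ b))

namespace IsAntipode

theorem sliceLeft_T₁_symm (hS : H.IsAntipode ε S) (a b : V) :
    sliceLeft ε (H.T₁.symm (a ⊗ₜ b)) = H.m (S a) b :=
  hS.isCounit.isAntipode_iff.1 hS a b

theorem unique (hS : H.IsAntipode ε S) {S' : V →ₗ[ℂ] V} (hS' : H.IsAntipode ε S') : S' = S :=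
  LinearMap.ext fun a => eq_of_m_left_eq (H := H) fun b => by
    rw [← hS.sliceLeft_T₁_symm, hS'.sliceLeft_T₁_symm]

theorem apply_sliceRight_T₁ (hS : H.IsAntipode ε S) (hφ : H.IsIntegral φ) (z : V ⊗[ℂ] V) :
    S (sliceRight φ (H.T₁ z)) = sliceRight φ (H.T₄ z) :=
  eq_of_m_left_eq (H := H) fun b => by
    rw [← hS.sliceLeft_T₁_symm, hφ.sliceLeft_T₁_symm hS.isCounit]

end IsAntipode

namespace IsIntegral

theorem exists_isAntipode (hφ : H.IsIntegral φ) (hε : H.IsCounit ε) :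
    ∃ S, H.IsAntipode ε S := by
  have h (a : V) : ∃ s, ∀ b, sliceLeft ε (H.T₁.symm (a ⊗ₜ b)) = H.m s b := by
    obtain ⟨w, rfl⟩ := sliceRight_surjective hφ.ne_zero a
    obtain ⟨z, rfl⟩ := H.T₁.surjective w
    exact ⟨_, hφ.sliceLeft_T₁_symm hε z⟩
  choose s hs using h
  let S : V →ₗ[ℂ] V :=
    { toFun := s
      map_add' := fun a a' => eq_of_m_left_eq (H := H) fun b => by
        simp [← hs, TensorProduct.add_tmul]
      map_smul' := fun r a => eq_of_m_left_eq (H := H) fun b => by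
        simp [← hs, ← TensorProduct.smul_tmul'] }
  exact ⟨S, hε.isAntipode_iff.2 hs⟩

theorem exists_antipode_equiv (hφ : H.IsIntegral φ) (hε : H.IsCounit ε) :
    ∃ S : V ≃ₗ[ℂ] V, H.IsAntipode ε S.toLinearMap ∧ H.op.IsAntipode ε S.symm.toLinearMap := by
  obtain ⟨S, hS⟩ := hφ.exists_isAntipode hε
  obtain ⟨S', hS'⟩ := hφ.op.exists_isAntipode hε.op
  have h (z : V ⊗[ℂ] V) : S' (sliceRight φ (H.T₄ z)) = sliceRight φ (H.T₁ z) := by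
    simpa [HopfData.op] using hS'.apply_sliceRight_T₁ hφ.op (TensorProduct.comm ℂ V V z)
  refine ⟨LinearEquiv.ofLinearMap S S' ?_ ?_, hS, hS'⟩
  · ext a
    obtain ⟨z, rfl⟩ := ((sliceRight_surjective hφ.ne_zero).comp H.T₄.surjective) a
    simp [h, hS.apply_sliceRight_T₁ hφ]
  · ext a
    obtain ⟨z, rfl⟩ := ((sliceRight_surjective hφ.ne_zero).comp H.T₁.surjective) a
    simp [h, hS.apply_sliceRight_T₁ hφ]

end IsIntegral

theorem IsCounit.lTensor_sliceLeft_coverLeft (hε : H.IsCounit ε) (a : V) (w : V ⊗[ℂ] V) :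
    lTensor V (sliceLeft ε) (H.coverLeft a w) = rTensor V (H.m a) w := by
  have h : lTensor V (sliceLeft ε) ∘ₗ H.coverLeft a = rTensor V (H.m a) :=
    TensorProduct.ext' fun b c => by
      simp [coverLeft, lTensor_sliceLeft_assoc_tmul, hε.sliceRight_T₂]
  exact LinearMap.congr_fun h w

theorem lift_m_rTensor_m (H : HopfData V) (a : V) (z : V ⊗[ℂ] V) :
    TensorProduct.lift H.m (rTensor V (H.m a) z) = H.m a (TensorProduct.lift H.m z) := by
  induction z <;> simp_all [H.m_assoc]

theorem lift_m_lTensor_m (H : HopfData V) (c : V) (z : V ⊗[ℂ] V) :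
    TensorProduct.lift H.m (lTensor V (H.m.flip c) z) = H.m (TensorProduct.lift H.m z) c := by
  induction z <;> simp_all [H.m_assoc]

namespace IsAntipode

theorem lTensor_comp_T₂ (hS : H.IsAntipode ε S) (a b c : V) :
    lTensor V (H.m.flip c ∘ₗ S) (H.T₂ (a ⊗ₜ b)) = rTensor V (H.m a) (H.T₁.symm (b ⊗ₜ c)) := by
  have h : (curry (sliceLeft ε ∘ₗ H.T₁.symm.toLinearMap)).flip c = H.m.flip c ∘ₗ S :=
    LinearMap.ext fun x => hS.sliceLeft_T₁_symm x c
  rw [← h, ← lTensor_coverLeft_tmul, LinearMap.lTensor_comp_apply, lTensor_T₁_symm_coverLeft,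
    hS.isCounit.lTensor_sliceLeft_coverLeft]

theorem lift_lTensor_T₂ (hS : H.IsAntipode ε S) (a b : V) :
    TensorProduct.lift H.m (lTensor V S (H.T₂ (a ⊗ₜ b))) = ε b • a :=
  eq_of_m_left_eq (H := H) fun c => by
    rw [← lift_m_lTensor_m, ← LinearMap.lTensor_comp_apply, hS.lTensor_comp_T₂, lift_m_rTensor_m,
      hS.isCounit.lift_T₁_symm]
    simp

theorem opCoop (hS : H.IsAntipode ε S) : H.opCoop.IsAntipode ε S where
  isCounit := hS.isCounit.opCoop
  lift_rTensor_T₁ a b := by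
    rw [← hS.lift_lTensor_T₂ b a]
    simp only [HopfData.opCoop, LinearEquiv.trans_apply, TensorProduct.comm_tmul]
    induction H.T₂ (b ⊗ₜ a) <;> simp_all

theorem sliceLeft_T₁_symm_leftΔ (hS : H.IsAntipode ε S) (p : V) (z : V ⊗[ℂ] V) :
    sliceLeft ε (H.T₁.symm (H.leftΔ p z)) = ε p • sliceLeft ε (H.T₁.symm z) :=
  apply_eq_apply_of_equiv_tmul H.T₁ (f := sliceLeft ε ∘ₗ H.T₁.symm.toLinearMap ∘ₗ H.leftΔ p)
    (g := ε p • (sliceLeft ε ∘ₗ H.T₁.symm.toLinearMap))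
    (fun r s => by simp [H.leftΔ_T₁, hS.isCounit.map_m, smul_smul]) z

theorem map_m (hS : H.IsAntipode ε S) (a b : V) : S (H.m a b) = H.m (S b) (S a) :=
  eq_of_m_left_eq (H := H) fun c => by
    have h := apply_eq_apply_of_equiv_tmul H.T₁
      (f := sliceLeft ε ∘ₗ H.T₁.symm.toLinearMap ∘ₗ rTensor V (H.m.flip b))
      (g := H.m (S b) ∘ₗ sliceLeft ε ∘ₗ H.T₁.symm.toLinearMap)
      (fun p q => by
        simp only [LinearMap.comp_apply, ← H.leftΔ_tmul_eq_T₁, LinearEquiv.coe_coe,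
          hS.sliceLeft_T₁_symm_leftΔ]
        simp [hS.sliceLeft_T₁_symm]) (a ⊗ₜ c)
    simpa [H.m_assoc, hS.sliceLeft_T₁_symm] using h

theorem comp_m_flip (hS : H.IsAntipode ε S) (d : V) : S ∘ₗ H.m.flip d = H.m (S d) ∘ₗ S :=
  LinearMap.ext fun x => hS.map_m x d

theorem lift_rTensor_T₃ (hS : H.IsAntipode ε S) (q d : V) :
    TensorProduct.lift H.m (rTensor V S (H.T₃ (q ⊗ₜ d))) = ε q • S d :=
  eq_of_m_left_eq (H := H) fun y => by
    rw [← lift_m_lTensor_m, ← rTensor_lTensor, ← H.leftΔ_tmul_eq_T₃, H.leftΔ_tmul_eq_T₁,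
      ← LinearMap.rTensor_comp_apply, hS.comp_m_flip, LinearMap.rTensor_comp_apply,
      lift_m_rTensor_m, hS.lift_rTensor_T₁]
    simp

theorem lTensor_lift_iteratedMap (hS : H.IsAntipode ε S) (a : V) (z : V ⊗[ℂ] V) :
    lTensor V (TensorProduct.lift H.m ∘ₗ rTensor V S) (H.iteratedMap a z) =
      a ⊗ₜ TensorProduct.lift H.m (rTensor V S z) := by
  refine apply_eq_apply_of_equiv_tmul H.T₃
    (f := lTensor V (TensorProduct.lift H.m ∘ₗ rTensor V S) ∘ₗ H.iteratedMap a)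
    (g := TensorProduct.mk ℂ V V a ∘ₗ TensorProduct.lift H.m ∘ₗ rTensor V S) (fun q d => ?_) z
  have h : (TensorProduct.lift H.m ∘ₗ rTensor V S) ∘ₗ (curry H.T₃.toLinearMap).flip d =
      LinearMap.toSpanSingleton ℂ V (S d) ∘ₗ ε :=
    LinearMap.ext fun r => hS.lift_rTensor_T₃ r d
  simp only [LinearMap.comp_apply, TensorProduct.mk_apply, iteratedMap_T₃, hS.lift_rTensor_T₃]
  rw [← LinearMap.lTensor_comp_apply, h, lTensor_toSpanSingleton_comp, hS.isCounit.sliceRight_T₁,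
    TensorProduct.smul_tmul]

end IsAntipode

section Anticomultiplicativity

theorem rTensor_m_leftΔ_tmul (H : HopfData V) (a b x y : V) :
    rTensor V (H.m a) (H.leftΔ b (x ⊗ₜ y)) =
      TensorProduct.map (H.m.flip x) (H.m.flip y) (H.T₂ (a ⊗ₜ b)) := by
  have h : H.m a ∘ₗ H.m.flip x = H.m.flip x ∘ₗ H.m a :=
    LinearMap.ext fun c => (H.m_assoc a c x).symm
  rw [H.leftΔ_tmul_eq_T₁, ← LinearMap.rTensor_comp_apply, h, LinearMap.rTensor_comp_apply,
    H.T₁_T₂, ← LinearMap.comp_apply, LinearMap.rTensor_comp_lTensor]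

theorem eq_of_forall_map_m_flip_eq {z z' : V ⊗[ℂ] V}
    (h : ∀ x y, TensorProduct.map (H.m.flip x) (H.m.flip y) z =
      TensorProduct.map (H.m.flip x) (H.m.flip y) z') : z = z' := by
  refine eq_of_forall_rTensor_eq H.m.flip H.eq_zero_of_m_right fun x =>
    eq_of_forall_lTensor_eq H.m.flip H.eq_zero_of_m_right fun y => ?_
  simpa only [← LinearMap.comp_apply, LinearMap.lTensor_comp_rTensor] using h x y

/-- The map `(u ⊗ v) ⊗ (x ⊗ y) ↦ S(v)x ⊗ S(u)y`. Comparing it with the action of `Δ(S(p))` shows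
that `S` is anti-comultiplicative. -/
def twistedAction (H : HopfData V) (S : V →ₗ[ℂ] V) :
    (V ⊗[ℂ] V) ⊗[ℂ] (V ⊗[ℂ] V) →ₗ[ℂ] V ⊗[ℂ] V :=
  TensorProduct.map (TensorProduct.lift H.m) (TensorProduct.lift H.m) ∘ₗ
    (TensorProduct.tensorTensorTensorComm ℂ V V V V).toLinearMap ∘ₗ
      rTensor (V ⊗[ℂ] V) (TensorProduct.map S S ∘ₗ (TensorProduct.comm ℂ V V).toLinearMap)

theorem twistedAction_tmul (S : V →ₗ[ℂ] V) (z : V ⊗[ℂ] V) (x y : V) :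
    H.twistedAction S (z ⊗ₜ (x ⊗ₜ y)) = TensorProduct.map (H.m.flip x) (H.m.flip y)
      (TensorProduct.comm ℂ V V (TensorProduct.map S S z)) := by
  induction z <;> simp_all [TensorProduct.add_tmul, twistedAction]

theorem twistedAction_rTensor_assoc (S : V →ₗ[ℂ] V) (f : V →ₗ[ℂ] V ⊗[ℂ] V) (t : V ⊗[ℂ] V)
    (s : V) :
    H.twistedAction S (rTensor (V ⊗[ℂ] V) f (assoc ℂ V V V (t ⊗ₜ s))) =
      TensorProduct.comm ℂ V V (rTensor V (H.m.flip s ∘ₗ S)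
        (lTensor V (TensorProduct.lift H.m ∘ₗ rTensor V S) (assoc ℂ V V V (rTensor V f t)))) := by
  induction t with
  | zero => simp
  | add x y hx hy => simp only [map_add, TensorProduct.add_tmul, hx, hy]
  | tmul r x =>
    simp only [TensorProduct.assoc_tmul, LinearMap.rTensor_tmul, twistedAction_tmul]
    induction f r <;> simp_all [TensorProduct.add_tmul]

namespace IsAntipode

theorem twistedAction_assoc_T₁ (hS : H.IsAntipode ε S) (b x : V) (w : V ⊗[ℂ] V) :
    H.twistedAction S (rTensor (V ⊗[ℂ] V) ((curry H.T₁.toLinearMap).flip b)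
      (assoc ℂ V V V (rTensor V ((curry H.T₁.toLinearMap).flip x) w))) =
        H.m (S b) x ⊗ₜ TensorProduct.lift H.m (rTensor V S w) := by
  induction w with
  | zero => simp
  | add w w' hw hw' => simp only [map_add, TensorProduct.tmul_add, hw, hw']
  | tmul r s =>
    simp only [LinearMap.rTensor_tmul, LinearMap.flip_apply, TensorProduct.curry_apply,
      LinearEquiv.coe_coe]
    rw [twistedAction_rTensor_assoc, ← iteratedMap_tmul, hS.lTensor_lift_iteratedMap]
    simp

theorem twistedAction_iteratedMap (hS : H.IsAntipode ε S) (a b : V) (z : V ⊗[ℂ] V) :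
    H.twistedAction S (rTensor (V ⊗[ℂ] V) ((curry H.T₁.toLinearMap).flip b)
      (H.iteratedMap a z)) = ε a • rTensor V (H.m (S b)) z := by
  induction z with
  | zero => simp
  | add x y hx hy => simp only [map_add, hx, hy, smul_add]
  | tmul x y =>
    rw [iteratedMap_tmul, hS.twistedAction_assoc_T₁, hS.lift_rTensor_T₁, TensorProduct.tmul_smul,
      LinearMap.rTensor_tmul]

theorem twistedAction_T₁ (hS : H.IsAntipode ε S) (p b : V) (w : V ⊗[ℂ] V) :
    H.twistedAction S (H.T₁ (p ⊗ₜ b) ⊗ₜ w) = rTensor V (H.m (S b)) (H.leftΔ (S p) w) := by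
  let lhs := H.twistedAction S ∘ₗ rTensor (V ⊗[ℂ] V) ((curry H.T₁.toLinearMap).flip b)
  let rhs := rTensor V (H.m (S b)) ∘ₗ TensorProduct.lift (H.leftΔ ∘ₗ S)
  have rhs_lTensor_T₃ (d : V) (t : V ⊗[ℂ] V) :
      rhs (lTensor V ((curry H.T₃.toLinearMap).flip d) t) =
        rTensor V (H.m (S b)) (H.T₃ (TensorProduct.lift H.m (rTensor V S t) ⊗ₜ d)) := by
    induction t with
    | zero => simp
    | add x y hx hy => simp only [map_add, TensorProduct.add_tmul, hx, hy]
    | tmul p r => simp [rhs, H.leftΔ_T₃]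
  have h (d : V) (t : V ⊗[ℂ] V) : lhs (lTensor V ((curry H.T₃.toLinearMap).flip d) t) =
      rhs (lTensor V ((curry H.T₃.toLinearMap).flip d) t) := by
    refine apply_eq_apply_of_equiv_tmul H.T₁
      (f := lhs ∘ₗ lTensor V ((curry H.T₃.toLinearMap).flip d))
      (g := rhs ∘ₗ lTensor V ((curry H.T₃.toLinearMap).flip d)) (fun a q => ?_) t
    refine Eq.trans ?_ (rhs_lTensor_T₃ d _).symm
    simp only [lhs, LinearMap.comp_apply]
    rw [← iteratedMap_T₃, hS.twistedAction_iteratedMap, hS.lift_rTensor_T₁,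
      ← TensorProduct.smul_tmul', map_smul, map_smul]
  exact apply_eq_apply_of_equiv_tmul H.T₃ (f := curry lhs p) (g := curry rhs p)
    (fun q d => h d (p ⊗ₜ q)) w

theorem map_T₁ (hS : H.IsAntipode ε S) (a b : V) :
    TensorProduct.map S S (H.T₁ (a ⊗ₜ b)) = TensorProduct.comm ℂ V V (H.T₂ (S b ⊗ₜ S a)) := by
  apply (TensorProduct.comm ℂ V V).injective
  refine eq_of_forall_map_m_flip_eq (H := H) fun x y => ?_
  rw [← twistedAction_tmul, hS.twistedAction_T₁, rTensor_m_leftΔ_tmul]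
  simp

end IsAntipode

end Anticomultiplicativity

namespace IsIntegral

theorem sliceRight_T₄_eq_zero (hφ : H.IsIntegral φ) {n : V} (hn : ∀ x, φ (H.m x n) = 0) (x : V) :
    sliceRight φ (H.T₄ (x ⊗ₜ n)) = 0 := by
  obtain ⟨ε, hε⟩ := H.exists_isCounit
  obtain ⟨S, hS⟩ := hφ.exists_isAntipode hε
  have hφn : φ ∘ₗ H.m.flip n = 0 := LinearMap.ext hn
  have h : sliceRight φ (H.T₁ (x ⊗ₜ n)) = 0 := H.eq_zero_of_m_left _ fun d => by
    rw [← sliceRight_rTensor, H.T₁_T₂, sliceRight_lTensor, hφn]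
    simp [sliceRight]
  rw [← hS.apply_sliceRight_T₁ hφ, h, map_zero]

theorem counit_eq_zero (hφ : H.IsIntegral φ) (hε : H.IsCounit ε) {n : V}
    (hn : ∀ x, φ (H.m x n) = 0) : ε n = 0 := by
  obtain ⟨S, hS, -⟩ := hφ.exists_antipode_equiv hε
  obtain ⟨y, hy⟩ := LinearMap.surjective hφ.ne_zero 1
  have h : TensorProduct.lift (H.m.compr₂ φ)
      (rTensor V S.toLinearMap (H.T₃ (n ⊗ₜ S.symm y))) = 0 := by
    refine lift_eq_zero_of_forall_sliceRight_eq_zero _ fun x => ?_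
    change sliceRight (φ ∘ₗ H.m x) _ = 0
    rw [sliceRight_rTensor, ← sliceRight_lTensor, H.T₃_T₄, sliceRight_rTensor,
      hφ.sliceRight_T₄_eq_zero hn, map_zero, map_zero]
  rw [TensorProduct.lift_compr₂, LinearMap.comp_apply, hS.lift_rTensor_T₃] at h
  simpa [hy] using h

theorem faithful (hφ : H.IsIntegral φ) {a : V} (ha : ∀ x, φ (H.m x a) = 0) : a = 0 := by
  obtain ⟨ε, hε⟩ := H.exists_isCounit
  refine H.eq_zero_of_m_left _ fun d => (Module.forall_dual_apply_eq_zero_iff ℂ _).1 fun ω => ?_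
  rw [← hε.sliceRight_T₂, ← apply_sliceLeft]
  refine hφ.counit_eq_zero hε fun x => ?_
  rw [← sliceLeft_lTensor, apply_sliceLeft, ← H.rightΔ_tmul_eq_T₂, H.rightΔ_tmul_eq_T₄,
    sliceRight_rTensor, hφ.sliceRight_T₄_eq_zero ha, map_zero, map_zero]

end IsIntegral

section BijectiveAntipode

variable {S : V ≃ₗ[ℂ] V}

theorem IsAntipode.map_T₃ (hS : H.IsAntipode ε S.toLinearMap) (a b : V) :
    TensorProduct.map S.toLinearMap S.toLinearMap (H.T₃ (a ⊗ₜ b)) =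
      TensorProduct.comm ℂ V V (H.T₄ (S b ⊗ₜ S a)) := by
  refine eq_of_forall_lTensor_eq (fun c => H.m (S c))
    (fun w hw => H.eq_zero_of_m_left w fun a => ?_)
    fun c => ?_
  · simpa using hw (S.symm a)
  calc lTensor V (H.m (S c)) (TensorProduct.map S.toLinearMap S.toLinearMap (H.T₃ (a ⊗ₜ b)))
      = TensorProduct.map S.toLinearMap S.toLinearMap (lTensor V (H.m.flip c) (H.T₃ (a ⊗ₜ b))) := by
        rw [← LinearMap.comp_apply, ← LinearMap.comp_apply, LinearMap.lTensor_comp_map,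
          LinearMap.map_comp_lTensor, hS.comp_m_flip]
        rfl
    _ = TensorProduct.map S.toLinearMap S.toLinearMap (rTensor V (H.m.flip b) (H.T₁ (a ⊗ₜ c))) := by
        rw [← H.leftΔ_tmul_eq_T₃, H.leftΔ_tmul_eq_T₁]
    _ = rTensor V (H.m (S b)) (TensorProduct.map S.toLinearMap S.toLinearMap (H.T₁ (a ⊗ₜ c))) := by
        rw [← LinearMap.comp_apply, ← LinearMap.comp_apply, LinearMap.rTensor_comp_map,
          LinearMap.map_comp_rTensor, hS.comp_m_flip]
        rfl
    _ = TensorProduct.comm ℂ V V (lTensor V (H.m (S b)) (H.T₂ (S c ⊗ₜ S a))) := by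
        rw [hS.map_T₁, rTensor, lTensor, TensorProduct.map_comm]
        rfl
    _ = TensorProduct.comm ℂ V V (rTensor V (H.m (S c)) (H.T₄ (S b ⊗ₜ S a))) := by
        rw [← H.rightΔ_tmul_eq_T₂, H.rightΔ_tmul_eq_T₄]
    _ = lTensor V (H.m (S c)) (TensorProduct.comm ℂ V V (H.T₄ (S b ⊗ₜ S a))) := by
        rw [lTensor, rTensor, TensorProduct.map_comm]

namespace IsIntegral

theorem ne_zero_comp (hφ : H.IsIntegral φ) (f : V ≃ₗ[ℂ] V) : φ ∘ₗ f.toLinearMap ≠ 0 := fun h =>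
  hφ.ne_zero <| LinearMap.ext fun x => by simpa using LinearMap.congr_fun h (f.symm x)

theorem sliceLeft_T₁ (hφ : H.IsIntegral φ) (hS : H.IsAntipode ε S.toLinearMap) (a b : V) :
    sliceLeft (φ ∘ₗ S.toLinearMap) (H.T₁ (a ⊗ₜ b)) = φ (S a) • b := by
  apply S.injective
  have := sliceLeft_map φ S.toLinearMap S.toLinearMap (H.T₁ (a ⊗ₜ b))
  rw [hS.map_T₁, sliceLeft_comm, hφ.sliceRight_T₂] at this
  simpa using this.symm

theorem sliceLeft_T₄ (hφ : H.IsIntegral φ) (hS : H.IsAntipode ε S.toLinearMap) (a b : V) :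
    sliceLeft (φ ∘ₗ S.toLinearMap) (H.T₄ (a ⊗ₜ b)) = φ (S b) • a :=
  eq_of_m_left_eq (H := H) fun y => by
    rw [← LinearMap.flip_apply H.m, ← sliceLeft_lTensor, ← H.T₁_T₄, sliceLeft_lTensor,
      hφ.sliceLeft_T₁ hS]
    simp

theorem opCoop (hφ : H.IsIntegral φ) (hS : H.IsAntipode ε S.toLinearMap) :
    H.opCoop.IsIntegral (φ ∘ₗ S.toLinearMap) where
  ne_zero := hφ.ne_zero_comp S
  sliceRight_T₃ a b := by
    simpa [HopfData.opCoop, sliceRight_comm] using hφ.sliceLeft_T₄ hS b a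
  sliceRight_T₂ a b := by
    simpa [HopfData.opCoop, sliceRight_comm] using hφ.sliceLeft_T₁ hS b a

theorem antipode_sliceLeft_T₂ (hφ : H.IsIntegral φ) (hS : H.IsAntipode ε S.toLinearMap)
    (z : V ⊗[ℂ] V) :
    S (sliceLeft (φ ∘ₗ S.toLinearMap) (H.T₂ z)) = sliceLeft (φ ∘ₗ S.toLinearMap) (H.T₃ z) := by
  simpa [HopfData.opCoop, sliceRight_comm] using
    hS.opCoop.apply_sliceRight_T₁ (hφ.opCoop hS) (TensorProduct.comm ℂ V V z)

theorem apply_m_sliceLeft_T₃_tmul (hφ : H.IsIntegral φ) (hS : H.IsAntipode ε S.toLinearMap)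
    (a c x : V) :
    φ (H.m x (sliceLeft φ (H.T₃ (c ⊗ₜ S a)))) =
      φ (S (H.m (sliceRight (φ ∘ₗ S.symm.toLinearMap) (H.T₄ (S c ⊗ₜ a))) x)) := by
  set ψ : Module.Dual ℂ V := φ ∘ₗ S.toLinearMap with hψ
  have hmul (a b : V) : S (H.m a b) = H.m (S b) (S a) := hS.map_m a b
  calc φ (H.m x (sliceLeft φ (H.T₃ (c ⊗ₜ S a))))
      = ψ (H.m a (sliceRight φ (H.T₁ (x ⊗ₜ c)))) := by
        have h : S (sliceRight φ (H.T₁ (x ⊗ₜ c))) = sliceRight φ (H.T₄ (x ⊗ₜ c)) :=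
          hS.apply_sliceRight_T₁ hφ (x ⊗ₜ c)
        rw [hψ, LinearMap.comp_apply, LinearEquiv.coe_coe, hmul, h, ← sliceLeft_lTensor,
          apply_sliceLeft, H.T₃_T₄, sliceRight_rTensor, LinearMap.flip_apply]
    _ = φ (H.m (sliceLeft ψ (H.T₂ (a ⊗ₜ x))) c) := by
        rw [← sliceRight_rTensor, H.T₁_T₂, ← apply_sliceLeft, sliceLeft_lTensor,
          LinearMap.flip_apply]
    _ = (φ ∘ₗ S.symm.toLinearMap) (H.m (S c) (sliceLeft ψ (H.T₃ (a ⊗ₜ x)))) := by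
        rw [← hφ.antipode_sliceLeft_T₂ hS, ← hmul]
        simp [hψ]
    _ = φ (S (H.m (sliceRight (φ ∘ₗ S.symm.toLinearMap) (H.T₄ (S c ⊗ₜ a))) x)) := by
        rw [← sliceLeft_lTensor, H.T₃_T₄, apply_sliceLeft, sliceRight_rTensor,
          LinearMap.flip_apply]
        rfl

theorem apply_m_sliceLeft_T₃ (hφ : H.IsIntegral φ) (hS : H.IsAntipode ε S.toLinearMap)
    (w : V ⊗[ℂ] V) (x : V) :
    φ (H.m x (sliceLeft φ (H.T₃ w))) = φ (S (H.m (sliceRight (φ ∘ₗ S.symm.toLinearMap)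
      (H.T₄ (TensorProduct.map S.toLinearMap S.symm.toLinearMap w))) x)) := by
  induction w with
  | zero => simp
  | add x y hx hy => simp only [map_add, LinearMap.add_apply, hx, hy]
  | tmul c a => simpa using hφ.apply_m_sliceLeft_T₃_tmul hS (S.symm a) c x

theorem apply_sliceLeft_T₃ (hφ : H.IsIntegral φ) (hS : H.IsAntipode ε S.toLinearMap)
    (w : V ⊗[ℂ] V) :
    φ (sliceLeft φ (H.T₃ w)) = φ (S (sliceRight (φ ∘ₗ S.symm.toLinearMap)
      (H.T₄ (TensorProduct.map S.toLinearMap S.symm.toLinearMap w)))) := by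
  induction w with
  | zero => simp
  | add x y hx hy => simp only [map_add, hx, hy]
  | tmul c a =>
    have h := apply_sliceLeft (φ ∘ₗ S.toLinearMap) (φ ∘ₗ S.symm.toLinearMap)
      (H.T₄ (S c ⊗ₜ S.symm a))
    rw [hφ.sliceLeft_T₄ hS] at h
    rw [apply_sliceLeft, hφ.sliceRight_T₃]
    simpa [mul_comm] using h

theorem exists_antipode_m_left_eq (hφ : H.IsIntegral φ) (hS : H.IsAntipode ε S.toLinearMap)
    (a : V) : ∃ v, (∀ x, φ (H.m x a) = φ (S (H.m v x))) ∧ φ a = φ (S v) := by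
  obtain ⟨w, rfl⟩ := ((sliceLeft_surjective hφ.ne_zero).comp H.T₃.surjective) a
  exact ⟨_, hφ.apply_m_sliceLeft_T₃ hS w, hφ.apply_sliceLeft_T₃ hS w⟩

theorem exists_m_right_eq (hφ : H.IsIntegral φ) (hS : H.IsAntipode ε S.toLinearMap)
    (v : V) : ∃ a, (∀ x, φ (H.m x a) = φ (S (H.m v x))) ∧ φ a = φ (S v) := by
  obtain ⟨w, rfl⟩ := ((sliceRight_surjective (hφ.ne_zero_comp S.symm)).comp
    (H.T₄.surjective.comp (TensorProduct.congr S S.symm).surjective)) v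
  exact ⟨_, hφ.apply_m_sliceLeft_T₃ hS w, hφ.apply_sliceLeft_T₃ hS w⟩

theorem apply_m_sliceRight (hφ : H.IsIntegral φ) (hS : H.IsAntipode ε S.toLinearMap)
    (z : V ⊗[ℂ] V) (x : V) :
    φ (H.m x (sliceRight (φ ∘ₗ S.toLinearMap) (H.T₃.symm z))) =
      φ (S (H.m x (sliceRight φ (H.T₁.symm z)))) := by
  have h₃ : φ (H.m x (sliceRight (φ ∘ₗ S.toLinearMap) (H.T₃.symm z))) =
      (φ ∘ₗ S.toLinearMap) (sliceRight φ (H.leftΔ x z)) :=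
    apply_eq_apply_of_equiv_tmul H.T₃
      (f := φ ∘ₗ H.m x ∘ₗ sliceRight (φ ∘ₗ S.toLinearMap) ∘ₗ H.T₃.symm.toLinearMap)
      (g := (φ ∘ₗ S.toLinearMap) ∘ₗ sliceRight φ ∘ₗ H.leftΔ x)
      (fun p q => by simp [H.leftΔ_T₃, hφ.sliceRight_T₃, mul_comm]) z
  have h₁ : φ (S (H.m x (sliceRight φ (H.T₁.symm z)))) =
      φ (sliceLeft (φ ∘ₗ S.toLinearMap) (H.leftΔ x z)) :=
    apply_eq_apply_of_equiv_tmul H.T₁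
      (f := φ ∘ₗ S.toLinearMap ∘ₗ H.m x ∘ₗ sliceRight φ ∘ₗ H.T₁.symm.toLinearMap)
      (g := φ ∘ₗ sliceLeft (φ ∘ₗ S.toLinearMap) ∘ₗ H.leftΔ x)
      (fun p q => by simp [H.leftΔ_T₁, hφ.sliceLeft_T₁ hS, mul_comm]) z
  rw [h₃, h₁, apply_sliceLeft]

theorem exists_antipode_m_right_eq (hφ : H.IsIntegral φ) (hS : H.IsAntipode ε S.toLinearMap)
    (a : V) : ∃ a', ∀ x, φ (H.m x a) = φ (S (H.m x a')) := by
  obtain ⟨z, rfl⟩ := ((sliceRight_surjective (hφ.ne_zero_comp S)).comp H.T₃.symm.surjective) a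
  exact ⟨_, hφ.apply_m_sliceRight hS z⟩

theorem exists_m_right_eq_antipode (hφ : H.IsIntegral φ) (hS : H.IsAntipode ε S.toLinearMap)
    (a : V) : ∃ a', ∀ x, φ (H.m x a') = φ (S (H.m x a)) := by
  obtain ⟨z, rfl⟩ := ((sliceRight_surjective hφ.ne_zero).comp H.T₁.symm.surjective) a
  exact ⟨_, hφ.apply_m_sliceRight hS z⟩

end IsIntegral

end BijectiveAntipode

end HopfData

section Multipliers

variable {R : Type*} [NonUnitalRing R] [Module ℂ R] [IsScalarTower ℂ R R] [SMulCommClass ℂ R R]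

theorem rightMul_mul (hR : NondegenerateProduct R) (m : MultiplierAlgebra R) (x y : R) :
    rightMul m (x * y) = x * rightMul m y := by
  rw [← sub_eq_zero]
  refine hR.1 _ fun z => ?_
  rw [sub_mul, rightMul_mul_eq, mul_assoc, mul_assoc, rightMul_mul_eq, sub_self]

theorem ofElem_injective (hR : NondegenerateProduct R) :
    Function.Injective (ofElem : R → MultiplierAlgebra R) := fun r s h => by
  rw [← sub_eq_zero]
  refine hR.1 _ fun b => ?_
  rw [sub_mul, sub_eq_zero]
  exact congrArg (fun m => leftMul m b) h

theorem ofElem_leftMul (hR : NondegenerateProduct R) (m : MultiplierAlgebra R) (r : R) :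
    ofElem (leftMul m r) = m * ofElem r :=
  Subtype.ext <| Prod.ext (LinearMap.ext fun x => (leftMul_mul hR m r x).symm)
    (MulOpposite.unop_injective <| LinearMap.ext fun x => (rightMul_mul_eq m x r).symm)

theorem ofElem_rightMul (hR : NondegenerateProduct R) (m : MultiplierAlgebra R) (r : R) :
    ofElem (rightMul m r) = ofElem r * m :=
  Subtype.ext <| Prod.ext (LinearMap.ext fun x => rightMul_mul_eq m r x)
    (MulOpposite.unop_injective <| LinearMap.ext fun x => (rightMul_mul hR m x r).symm)

end Multipliers

section Tensor

variable {A : Type*} [NonUnitalRing A] [Module ℂ A] [IsScalarTower ℂ A A] [SMulCommClass ℂ A A]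

theorem tmulOne_mul_oneTmul (a b : A) : tmulOne a * oneTmul b = ofElem (a ⊗ₜ[ℂ] b) :=
  Subtype.ext <| Prod.ext (TensorProduct.ext' fun x y => by simp [tmulOne, oneTmul, ofElem])
    (MulOpposite.unop_injective <| TensorProduct.ext' fun x y => by
      simp [tmulOne, oneTmul, ofElem])

theorem oneTmul_mul_tmulOne (a b : A) : oneTmul b * tmulOne a = ofElem (a ⊗ₜ[ℂ] b) :=
  Subtype.ext <| Prod.ext (TensorProduct.ext' fun x y => by simp [tmulOne, oneTmul, ofElem])
    (MulOpposite.unop_injective <| TensorProduct.ext' fun x y => by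
      simp [tmulOne, oneTmul, ofElem])

theorem tensorFunctional_eq_sliceLeft (ω ω' : Module.Dual ℂ A) (z : A ⊗[ℂ] A) :
    tensorFunctional ω ω' z = ω' (sliceLeft ω z) := by
  induction z <;> simp_all

theorem tensorFunctional_eq_sliceRight (ω ω' : Module.Dual ℂ A) (z : A ⊗[ℂ] A) :
    tensorFunctional ω ω' z = ω (sliceRight ω' z) := by
  rw [tensorFunctional_eq_sliceLeft, apply_sliceLeft]

theorem sliceLeft_leftMul_oneTmul (ω : Module.Dual ℂ A) (a : A) (z : A ⊗[ℂ] A) :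
    sliceLeft ω (leftMul (oneTmul a) z) = a * sliceLeft ω z :=
  sliceLeft_lTensor ω (LinearMap.mulLeft ℂ a) z

theorem sliceLeft_rightMul_oneTmul (ω : Module.Dual ℂ A) (a : A) (z : A ⊗[ℂ] A) :
    sliceLeft ω (rightMul (oneTmul a) z) = sliceLeft ω z * a :=
  sliceLeft_lTensor ω (LinearMap.mulRight ℂ a) z

theorem sliceRight_leftMul_tmulOne (ω : Module.Dual ℂ A) (a : A) (z : A ⊗[ℂ] A) :
    sliceRight ω (leftMul (tmulOne a) z) = a * sliceRight ω z :=
  sliceRight_rTensor ω (LinearMap.mulLeft ℂ a) z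

theorem sliceRight_rightMul_tmulOne (ω : Module.Dual ℂ A) (a : A) (z : A ⊗[ℂ] A) :
    sliceRight ω (rightMul (tmulOne a) z) = sliceRight ω z * a :=
  sliceRight_rTensor ω (LinearMap.mulRight ℂ a) z

/-- The linear map `a ↦ ω(a ·)` from `A` to its dual space; the left-handed counterpart of
`rightTranslate`. -/
def leftTranslate (ω : Module.Dual ℂ A) : A →ₗ[ℂ] Module.Dual ℂ A :=
  (LinearMap.mul ℂ A).compr₂ ω

end Tensor

namespace RegularMultiplierHopfAlgebra

variable {A : Type*} [NonUnitalRing A] [Module ℂ A] [IsScalarTower ℂ A A] [SMulCommClass ℂ A A]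

section HopfData

variable (H : RegularMultiplierHopfAlgebra A)

theorem leftMul_tmulOne_T₁ (a b c : A) : leftMul (tmulOne a) (H.T₁ (b ⊗ₜ c)) =
    rightMul (oneTmul c) (H.T₂ (a ⊗ₜ b)) := ofElem_injective H.nondegenerate.tensor <| by
  rw [ofElem_leftMul H.nondegenerate.tensor, ofElem_rightMul H.nondegenerate.tensor, H.of_T₁,
    H.of_T₂, mul_assoc]

theorem leftMul_oneTmul_T₃ (a b c : A) : leftMul (oneTmul a) (H.T₃ (b ⊗ₜ c)) =
    rightMul (tmulOne c) (H.T₄ (a ⊗ₜ b)) := ofElem_injective H.nondegenerate.tensor <| by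
  rw [ofElem_leftMul H.nondegenerate.tensor, ofElem_rightMul H.nondegenerate.tensor, H.of_T₃,
    H.of_T₄, mul_assoc]

theorem leftMul_tmulOne_T₃ (a b c : A) : leftMul (tmulOne a) (H.T₃ (b ⊗ₜ c)) =
    rightMul (tmulOne c) (H.T₂ (a ⊗ₜ b)) := ofElem_injective H.nondegenerate.tensor <| by
  rw [ofElem_leftMul H.nondegenerate.tensor, ofElem_rightMul H.nondegenerate.tensor, H.of_T₃,
    H.of_T₂, mul_assoc]

theorem leftMul_oneTmul_T₁ (a b c : A) : leftMul (oneTmul a) (H.T₁ (b ⊗ₜ c)) =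
    rightMul (oneTmul c) (H.T₄ (a ⊗ₜ b)) := ofElem_injective H.nondegenerate.tensor <| by
  rw [ofElem_leftMul H.nondegenerate.tensor, ofElem_rightMul H.nondegenerate.tensor, H.of_T₁,
    H.of_T₄, mul_assoc]

theorem rightMul_Δ_tmul_eq_T₂ (a x y : A) : rightMul (H.Δ a) (x ⊗ₜ y) =
    leftMul (oneTmul y) (H.T₂ (x ⊗ₜ a)) := ofElem_injective H.nondegenerate.tensor <| by
  rw [ofElem_leftMul H.nondegenerate.tensor, ofElem_rightMul H.nondegenerate.tensor, H.of_T₂,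
    ← mul_assoc, oneTmul_mul_tmulOne]

theorem rightMul_Δ_tmul_eq_T₄ (a x y : A) : rightMul (H.Δ a) (x ⊗ₜ y) =
    leftMul (tmulOne x) (H.T₄ (y ⊗ₜ a)) := ofElem_injective H.nondegenerate.tensor <| by
  rw [ofElem_leftMul H.nondegenerate.tensor, ofElem_rightMul H.nondegenerate.tensor, H.of_T₄,
    ← mul_assoc, tmulOne_mul_oneTmul]

theorem leftMul_Δ_T₁ (a b c : A) : leftMul (H.Δ a) (H.T₁ (b ⊗ₜ c)) = H.T₁ ((a * b) ⊗ₜ c) :=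
  ofElem_injective H.nondegenerate.tensor <| by
    rw [ofElem_leftMul H.nondegenerate.tensor, H.of_T₁, H.of_T₁, map_mul, mul_assoc]

theorem rightMul_Δ_T₂ (a b c : A) : rightMul (H.Δ a) (H.T₂ (b ⊗ₜ c)) = H.T₂ (b ⊗ₜ (c * a)) :=
  ofElem_injective H.nondegenerate.tensor <| by
    rw [ofElem_rightMul H.nondegenerate.tensor, H.of_T₂, H.of_T₂, map_mul, mul_assoc]

theorem rightMul_Δ_T₄ (a b c : A) : rightMul (H.Δ a) (H.T₄ (b ⊗ₜ c)) = H.T₄ (b ⊗ₜ (c * a)) :=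
  ofElem_injective H.nondegenerate.tensor <| by
    rw [ofElem_rightMul H.nondegenerate.tensor, H.of_T₄, H.of_T₄, map_mul, mul_assoc]

theorem assoc_rTensor_T₁ (a b c : A) :
    assoc ℂ A A A (rTensor A (curry H.T₂.toLinearMap a) (H.T₁ (b ⊗ₜ c))) =
      lTensor A ((curry H.T₁.toLinearMap).flip c) (H.T₂ (a ⊗ₜ b)) := by
  have rTensor_curry (z : A ⊗[ℂ] A) : rTensor A (curry H.T₂.toLinearMap a) z =
      TensorProduct.map H.T₂.toLinearMap LinearMap.id ((assoc ℂ A A A).symm (a ⊗ₜ z)) := by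
    induction z <;> simp_all [TensorProduct.tmul_add]
  rw [rTensor_curry, H.coassoc, LinearEquiv.apply_symm_apply]
  exact lTensor_assoc_tmul _ _ _

/- Multiplying by `d` on the left in the first leg and by `f` on the right in the third one turns
`T₃` into `T₂` and `T₄` into `T₁`. -/
theorem assoc_rTensor_T₄ (a b c : A) :
    assoc ℂ A A A (rTensor A ((curry H.T₃.toLinearMap).flip a) (H.T₄ (c ⊗ₜ b))) =
      lTensor A (curry H.T₄.toLinearMap c) (H.T₃ (b ⊗ₜ a)) := by
  refine eq_of_forall_rTensor_eq (fun d => LinearMap.mulLeft ℂ d)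
    (fun w hw => H.nondegenerate.2 w hw) fun d =>
      eq_of_forall_lTensor_eq (fun f : A => lTensor A (LinearMap.mulRight ℂ f))
        (fun w hw => eq_zero_of_mulRight_snd H.nondegenerate w hw) fun f => ?_
  have T₃_T₂ : rTensor A (LinearMap.mulLeft ℂ d) ∘ₗ (curry H.T₃.toLinearMap).flip a =
      rTensor A (LinearMap.mulRight ℂ a) ∘ₗ curry H.T₂.toLinearMap d :=
    LinearMap.ext fun x => H.leftMul_tmulOne_T₃ d x a
  have T₄_T₁ : lTensor A (LinearMap.mulRight ℂ f) ∘ₗ curry H.T₄.toLinearMap c =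
      lTensor A (LinearMap.mulLeft ℂ c) ∘ₗ (curry H.T₁.toLinearMap).flip f :=
    LinearMap.ext fun x => (H.leftMul_oneTmul_T₁ c x f).symm
  have assoc_comp (p q : A →ₗ[ℂ] A) (h : A →ₗ[ℂ] A ⊗[ℂ] A) (z : A ⊗[ℂ] A) :
      lTensor A (lTensor A q) (rTensor (A ⊗[ℂ] A) p (assoc ℂ A A A (rTensor A h z))) =
        assoc ℂ A A A (rTensor A (rTensor A p ∘ₗ h) (lTensor A q z)) := by
    rw [rTensor_assoc, lTensor_lTensor_assoc, ← LinearMap.rTensor_comp_apply, rTensor_lTensor]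
  have lTensor_comp (p q : A →ₗ[ℂ] A) (h : A →ₗ[ℂ] A ⊗[ℂ] A) (z : A ⊗[ℂ] A) :
      lTensor A (lTensor A q) (rTensor (A ⊗[ℂ] A) p (lTensor A h z)) =
        lTensor A (lTensor A q ∘ₗ h) (rTensor A p z) := by
    rw [rTensor_lTensor, ← LinearMap.lTensor_comp_apply]
  rw [assoc_comp, T₃_T₂, show lTensor A (LinearMap.mulRight ℂ f) (H.T₄ (c ⊗ₜ b)) =
    lTensor A (LinearMap.mulLeft ℂ c) (H.T₁ (b ⊗ₜ f)) from LinearMap.congr_fun T₄_T₁ b,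
    ← assoc_comp, H.assoc_rTensor_T₁, lTensor_comp, lTensor_comp, T₄_T₁,
    show rTensor A (LinearMap.mulLeft ℂ d) (H.T₃ (b ⊗ₜ a)) =
    rTensor A (LinearMap.mulRight ℂ a) (H.T₂ (d ⊗ₜ b)) from LinearMap.congr_fun T₃_T₂ b]

/-- The operations of a regular multiplier Hopf algebra, with multipliers replaced by the linear
maps through which they act. -/
def toHopfData : HopfData A where
  m := LinearMap.mul ℂ A
  m_assoc := mul_assoc
  eq_zero_of_m_right := H.nondegenerate.1
  eq_zero_of_m_left := H.nondegenerate.2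
  T₁ := H.T₁
  T₂ := H.T₂
  T₃ := H.T₃
  T₄ := H.T₄
  leftΔ := LinearMap.mk₂ ℂ (fun a => leftMul (H.Δ a)) (by simp [leftMul]) (by simp [leftMul])
    (by simp) (by simp)
  rightΔ := LinearMap.mk₂ ℂ (fun a => rightMul (H.Δ a)) (by simp [rightMul]) (by simp [rightMul])
    (by simp) (by simp)
  leftΔ_tmul_eq_T₁ := H.left_tmul_eq_T₁
  leftΔ_tmul_eq_T₃ := H.left_tmul_eq_T₃
  rightΔ_tmul_eq_T₂ := H.rightMul_Δ_tmul_eq_T₂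
  rightΔ_tmul_eq_T₄ := H.rightMul_Δ_tmul_eq_T₄
  leftΔ_T₁ := H.leftMul_Δ_T₁
  leftΔ_T₃ := H.left_T₃
  rightΔ_T₂ := H.rightMul_Δ_T₂
  rightΔ_T₄ := H.rightMul_Δ_T₄
  T₁_T₂ := H.leftMul_tmulOne_T₁
  T₃_T₄ := H.leftMul_oneTmul_T₃
  T₃_T₂ := H.leftMul_tmulOne_T₃
  T₁_T₄ := H.leftMul_oneTmul_T₁
  coassoc₂₁ := H.assoc_rTensor_T₁
  coassoc₃₄ := H.assoc_rTensor_T₄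

end HopfData

section Dual

variable {H : RegularMultiplierHopfAlgebra A} {φ ε : Module.Dual ℂ A} {S : A ≃ₗ[ℂ] A}

theorem tensorPairing_tmul_tmul (b b' : dualSpace φ) (a a' : A) :
    tensorPairing φ (b ⊗ₜ b') (a ⊗ₜ a') = (b : Module.Dual ℂ A) a * (b' : Module.Dual ℂ A) a' :=
  rfl

theorem tensorPairing_ext {w w' : dualSpace φ ⊗[ℂ] dualSpace φ}
    (h : ∀ a a', tensorPairing φ w (a ⊗ₜ a') = tensorPairing φ w' (a ⊗ₜ a')) : w = w' := by
  let evalAt (a : A) : dualSpace φ →ₗ[ℂ] ℂ := LinearMap.applyₗ a ∘ₗ (dualSpace φ).subtype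
  have separates (b : dualSpace φ) (hb : ∀ a, evalAt a b = 0) : b = 0 :=
    Subtype.ext (LinearMap.ext hb)
  have eval_eval (a a' : A) (w : dualSpace φ ⊗[ℂ] dualSpace φ) :
      TensorProduct.lid ℂ ℂ (lTensor ℂ (evalAt a') (rTensor (dualSpace φ) (evalAt a) w)) =
        tensorPairing φ w (a ⊗ₜ a') := by
    induction w <;> simp_all [evalAt, tensorPairing_tmul_tmul]
  refine eq_of_forall_rTensor_eq evalAt separates fun a =>
    eq_of_forall_lTensor_eq evalAt separates fun a' => (TensorProduct.lid ℂ ℂ).injective ?_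
  rw [eval_eval, eval_eval, h]

namespace IsLeftIntegral

theorem isIntegral (hφ : H.IsLeftIntegral φ) : H.toHopfData.IsIntegral φ :=
  ⟨hφ.1, hφ.2.1, fun a b => hφ.2.2 b a⟩

theorem dualMul_left_cancel (hφ : H.IsLeftIntegral φ) {b b₁ : dualSpace φ}
    (h : ∀ b', hφ.dualMul b b' = hφ.dualMul b₁ b') : b = b₁ := by
  refine Subtype.ext (LinearMap.ext fun x => ?_)
  obtain ⟨z, rfl⟩ := sliceRight_surjective hφ.1 x
  rw [← tensorFunctional_eq_sliceRight, ← tensorFunctional_eq_sliceRight]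
  refine apply_eq_apply_of_equiv_tmul H.T₁ (fun p q => ?_) z
  rw [← hφ.dualMul_tmul b ⟨_, q, rfl⟩ p q rfl, ← hφ.dualMul_tmul b₁ ⟨_, q, rfl⟩ p q rfl, h]

theorem rightTranslate_injective (hφ : H.IsLeftIntegral φ) :
    Function.Injective (rightTranslate φ) :=
  (injective_iff_map_eq_zero _).2 fun _ ha =>
    hφ.isIntegral.faithful fun x => LinearMap.congr_fun ha x

theorem leftTranslate_injective (hφ : H.IsLeftIntegral φ)
    (hS : H.toHopfData.IsAntipode ε S.toLinearMap) :
    Function.Injective (leftTranslate (rightIntegral φ S)) :=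
  (injective_iff_map_eq_zero _).2 fun _ ha =>
    (hφ.isIntegral.opCoop hS).faithful fun x => LinearMap.congr_fun ha x

theorem rightTranslate_rightIntegral_injective (hφ : H.IsLeftIntegral φ)
    (hS : H.toHopfData.IsAntipode ε S.toLinearMap) :
    Function.Injective (rightTranslate (rightIntegral φ S)) :=
  (injective_iff_map_eq_zero _).2 fun _ ha =>
    (hφ.isIntegral.opCoop hS).op.faithful fun x => LinearMap.congr_fun ha x

theorem range_leftTranslate (hφ : H.IsLeftIntegral φ)
    (hS : H.toHopfData.IsAntipode ε S.toLinearMap) :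
    LinearMap.range (leftTranslate (rightIntegral φ S)) = dualSpace φ := by
  apply le_antisymm
  · rintro _ ⟨v, rfl⟩
    obtain ⟨a, ha, -⟩ := hφ.isIntegral.exists_m_right_eq hS v
    exact ⟨a, LinearMap.ext ha⟩
  · rintro _ ⟨a, rfl⟩
    obtain ⟨v, hv, -⟩ := hφ.isIntegral.exists_antipode_m_left_eq hS a
    exact ⟨v, LinearMap.ext fun x => (hv x).symm⟩

theorem dualSpace_rightIntegral (hφ : H.IsLeftIntegral φ)
    (hS : H.toHopfData.IsAntipode ε S.toLinearMap) :
    dualSpace (rightIntegral φ S) = dualSpace φ := by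
  apply le_antisymm
  · rintro _ ⟨a, rfl⟩
    obtain ⟨a', ha'⟩ := hφ.isIntegral.exists_m_right_eq_antipode hS a
    exact ⟨a', LinearMap.ext ha'⟩
  · rintro _ ⟨a, rfl⟩
    obtain ⟨a', ha'⟩ := hφ.isIntegral.exists_antipode_m_right_eq hS a
    exact ⟨a', LinearMap.ext fun x => (ha' x).symm⟩

/-- The Fourier transform `a ↦ φ(· a)` from `A` onto `Â`. -/
def fourier (hφ : H.IsLeftIntegral φ) : A ≃ₗ[ℂ] dualSpace φ :=
  LinearEquiv.ofInjective (rightTranslate φ) hφ.rightTranslate_injective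

theorem fourier_apply (hφ : H.IsLeftIntegral φ) (a x : A) :
    (hφ.fourier a : Module.Dual ℂ A) x = φ (x * a) := rfl

/-- The Fourier transform `a ↦ ψ(a ·)` from `A` onto `Â`, where `ψ = φ ∘ S`. -/
def leftFourier (hφ : H.IsLeftIntegral φ) (hS : H.toHopfData.IsAntipode ε S.toLinearMap) :
    A ≃ₗ[ℂ] dualSpace φ :=
  LinearEquiv.ofInjective (leftTranslate (rightIntegral φ S)) (hφ.leftTranslate_injective hS) ≪≫ₗ
    LinearEquiv.ofEq _ _ (hφ.range_leftTranslate hS)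

theorem leftFourier_apply (hφ : H.IsLeftIntegral φ)
    (hS : H.toHopfData.IsAntipode ε S.toLinearMap) (a x : A) :
    (hφ.leftFourier hS a : Module.Dual ℂ A) x = rightIntegral φ S (a * x) := rfl

/-- The antipode `b ↦ b ∘ S` of `Â`. It sends `φ(· c)` to `ψ(S⁻¹(c) ·)`, whence this definition as
a composition of bijections. -/
def dualAntipode (hφ : H.IsLeftIntegral φ) (hS : H.toHopfData.IsAntipode ε S.toLinearMap) :
    dualSpace φ ≃ₗ[ℂ] dualSpace φ :=
  hφ.fourier.symm ≪≫ₗ S.symm ≪≫ₗ hφ.leftFourier hS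

theorem dualAntipode_apply (hφ : H.IsLeftIntegral φ)
    (hS : H.toHopfData.IsAntipode ε S.toLinearMap) (b : dualSpace φ) (x : A) :
    (hφ.dualAntipode hS b : Module.Dual ℂ A) x = (b : Module.Dual ℂ A) (S x) := by
  obtain ⟨c, rfl⟩ := hφ.fourier.surjective b
  have map_mul_symm : S (S.symm c * x) = S x * c :=
    (hS.map_m (S.symm c) x).trans (by simp [toHopfData])
  simp [dualAntipode, leftFourier_apply, fourier_apply, rightIntegral, map_mul_symm]

/-- The Fourier transform `a ↦ ψ(S(·)a)` from `A` onto `Â`, where `ψ = φ ∘ S`. -/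
def antipodeFourier (hφ : H.IsLeftIntegral φ) (hS : H.toHopfData.IsAntipode ε S.toLinearMap) :
    A ≃ₗ[ℂ] dualSpace φ :=
  LinearEquiv.ofInjective (rightTranslate (rightIntegral φ S))
      (hφ.rightTranslate_rightIntegral_injective hS) ≪≫ₗ
    LinearEquiv.ofEq _ _ (hφ.dualSpace_rightIntegral hS) ≪≫ₗ hφ.dualAntipode hS

theorem antipodeFourier_apply (hφ : H.IsLeftIntegral φ)
    (hS : H.toHopfData.IsAntipode ε S.toLinearMap) (a x : A) :
    (hφ.antipodeFourier hS a : Module.Dual ℂ A) x = rightIntegral φ S (S x * a) :=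
  hφ.dualAntipode_apply hS _ x

/-- The counit `φ(· a) ↦ φ(a)` of `Â`, that is, evaluation at the unit of `M(A)`. -/
def dualCounit (hφ : H.IsLeftIntegral φ) : Module.Dual ℂ (dualSpace φ) :=
  φ ∘ₗ hφ.fourier.symm.toLinearMap

theorem dualCounit_fourier (hφ : H.IsLeftIntegral φ) (a : A) :
    hφ.dualCounit (hφ.fourier a) = φ a := by
  simp [dualCounit]

theorem dualCounit_leftFourier (hφ : H.IsLeftIntegral φ)
    (hS : H.toHopfData.IsAntipode ε S.toLinearMap) (v : A) :
    hφ.dualCounit (hφ.leftFourier hS v) = rightIntegral φ S v := by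
  obtain ⟨a, ha, hav⟩ := hφ.isIntegral.exists_m_right_eq hS v
  have : hφ.leftFourier hS v = hφ.fourier a :=
    Subtype.ext (LinearMap.ext fun x => (ha x).symm)
  rw [this, dualCounit_fourier, hav]
  rfl

theorem dualMulTensor_congr_fourier (hφ : H.IsLeftIntegral φ) (z : A ⊗[ℂ] A) (x : A) :
    (hφ.dualMulTensor (TensorProduct.congr hφ.fourier hφ.fourier z) : Module.Dual ℂ A) x =
      tensorFunctional φ φ (leftMul (H.Δ x) z) := by
  induction z with
  | zero => simp
  | add y z hy hz => simp only [map_add, Submodule.coe_add, LinearMap.add_apply, hy, hz]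
  | tmul c c' =>
    rw [TensorProduct.congr_tmul, dualMulTensor_tmul]
    exact hφ.dualMul_apply _ _ c c' rfl rfl x

theorem dualMul_leftFourier (hφ : H.IsLeftIntegral φ)
    (hS : H.toHopfData.IsAntipode ε S.toLinearMap) (p : A) (b : dualSpace φ) (x : A) :
    (hφ.dualMul (hφ.leftFourier hS p) b : Module.Dual ℂ A) x =
      (b : Module.Dual ℂ A) (sliceLeft (rightIntegral φ S) (H.T₂ (p ⊗ₜ x))) := by
  obtain ⟨c, rfl⟩ := hφ.fourier.surjective b
  rw [hφ.dualMul_tmul _ _ x c rfl, tensorFunctional_eq_sliceRight, leftFourier_apply,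
    ← sliceRight_leftMul_tmulOne, leftMul_tmulOne_T₁, fourier_apply, ← sliceLeft_rightMul_oneTmul,
    apply_sliceLeft]

theorem dualMulTensor_congr_leftFourier (hφ : H.IsLeftIntegral φ)
    (hS : H.toHopfData.IsAntipode ε S.toLinearMap) (z : A ⊗[ℂ] A) (x : A) :
    (hφ.dualMulTensor (TensorProduct.congr (hφ.leftFourier hS) (hφ.leftFourier hS) z) :
        Module.Dual ℂ A) x =
      tensorFunctional (rightIntegral φ S) (rightIntegral φ S) (rightMul (H.Δ x) z) := by
  induction z with
  | zero => simp
  | add y z hy hz => simp only [map_add, Submodule.coe_add, LinearMap.add_apply, hy, hz]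
  | tmul p q =>
    rw [TensorProduct.congr_tmul, dualMulTensor_tmul, dualMul_leftFourier, leftFourier_apply,
      ← sliceLeft_leftMul_oneTmul, ← rightMul_Δ_tmul_eq_T₂, tensorFunctional_eq_sliceLeft]

theorem dualMul_dualAntipode_fourier (hφ : H.IsLeftIntegral φ)
    (hS : H.toHopfData.IsAntipode ε S.toLinearMap) (c a : A) :
    hφ.dualMul (hφ.dualAntipode hS (hφ.fourier c)) (hφ.fourier a) =
      hφ.fourier (sliceLeft φ (H.T₃ (a ⊗ₜ c))) := by
  refine Subtype.ext (LinearMap.ext fun x => ?_)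
  have antipode_slice : S (sliceRight φ (H.T₁ (x ⊗ₜ a))) = sliceRight φ (H.T₄ (x ⊗ₜ a)) :=
    hS.apply_sliceRight_T₁ hφ.isIntegral (x ⊗ₜ a)
  rw [hφ.dualMul_tmul _ _ x a rfl, tensorFunctional_eq_sliceRight, dualAntipode_apply,
    fourier_apply, antipode_slice, ← sliceRight_rightMul_tmulOne, ← leftMul_oneTmul_T₃,
    ← apply_sliceLeft, sliceLeft_leftMul_oneTmul, fourier_apply]

theorem dualMul_leftFourier_dualAntipode (hφ : H.IsLeftIntegral φ)
    (hS : H.toHopfData.IsAntipode ε S.toLinearMap) (p q : A) :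
    hφ.dualMul (hφ.leftFourier hS p) (hφ.dualAntipode hS (hφ.leftFourier hS q)) =
      hφ.leftFourier hS (sliceRight (rightIntegral φ S) (H.T₄ (q ⊗ₜ p))) := by
  refine Subtype.ext (LinearMap.ext fun x => ?_)
  have antipode_slice : S (sliceLeft (rightIntegral φ S) (H.T₂ (p ⊗ₜ x))) =
      sliceLeft (rightIntegral φ S) (H.T₃ (p ⊗ₜ x)) :=
    hφ.isIntegral.antipode_sliceLeft_T₂ hS (p ⊗ₜ x)
  rw [dualMul_leftFourier, dualAntipode_apply, antipode_slice, leftFourier_apply,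
    ← sliceLeft_leftMul_oneTmul, leftMul_oneTmul_T₃, apply_sliceLeft, sliceRight_rightMul_tmulOne,
    leftFourier_apply]

theorem tensorFunctional_antipodeFourier (hφ : H.IsLeftIntegral φ)
    (hS : H.toHopfData.IsAntipode ε S.toLinearMap) (a : A) (z : A ⊗[ℂ] A) :
    tensorFunctional φ (hφ.antipodeFourier hS a : Module.Dual ℂ A) z =
      rightIntegral φ S (sliceLeft (φ ∘ₗ S.symm.toLinearMap)
        (TensorProduct.map S.toLinearMap S.toLinearMap z) * a) := by
  induction z with
  | zero => simp
  | add x y hx hy => simp only [map_add, add_mul, hx, hy]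
  | tmul p q => simp [antipodeFourier_apply, smul_mul_assoc]

theorem dualMul_fourier_antipodeFourier (hφ : H.IsLeftIntegral φ)
    (hS : H.toHopfData.IsAntipode ε S.toLinearMap) (c a : A) :
    hφ.dualMul (hφ.fourier c) (hφ.antipodeFourier hS a) =
      hφ.antipodeFourier hS (sliceRight φ (H.T₁ (a ⊗ₜ c))) := by
  refine Subtype.ext (LinearMap.ext fun x => ?_)
  set ψ := rightIntegral φ S
  have map_mul (p q : A) : S (p * q) = S q * S p := hS.map_m p q
  have map_T₃ : TensorProduct.map S.toLinearMap S.toLinearMap (H.T₃ (x ⊗ₜ c)) =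
      TensorProduct.comm ℂ A A (H.T₄ (S c ⊗ₜ S x)) := hS.map_T₃ x c
  have antipode_slice : S (sliceLeft ψ (H.T₂ (S x ⊗ₜ a))) = sliceLeft ψ (H.T₃ (S x ⊗ₜ a)) :=
    hφ.isIntegral.antipode_sliceLeft_T₂ hS (S x ⊗ₜ a)
  calc (hφ.dualMul (hφ.fourier c) (hφ.antipodeFourier hS a) : Module.Dual ℂ A) x
      = ψ (sliceRight (φ ∘ₗ S.symm.toLinearMap) (H.T₄ (S c ⊗ₜ S x)) * a) := by
        rw [hφ.dualMul_tmul' _ _ x c rfl, tensorFunctional_antipodeFourier, map_T₃, sliceLeft_comm]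
    _ = φ (S.symm (S c * sliceLeft ψ (H.T₃ (S x ⊗ₜ a)))) := by
        rw [← sliceRight_rightMul_tmulOne, ← leftMul_oneTmul_T₃, ← apply_sliceLeft,
          sliceLeft_leftMul_oneTmul]
        rfl
    _ = φ (sliceLeft ψ (H.T₂ (S x ⊗ₜ a)) * c) := by
        rw [← antipode_slice, ← map_mul, S.symm_apply_apply]
    _ = ψ (S x * sliceRight φ (H.T₁ (a ⊗ₜ c))) := by
        rw [← sliceLeft_rightMul_oneTmul, ← leftMul_tmulOne_T₁, apply_sliceLeft,
          sliceRight_leftMul_tmulOne]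
    _ = (hφ.antipodeFourier hS (sliceRight φ (H.T₁ (a ⊗ₜ c))) : Module.Dual ℂ A) x :=
        (hφ.antipodeFourier_apply hS _ x).symm

/-- The map `b ⊗ b' ↦ Δ(b)(1 ⊗ b')` of `Â ⊗ Â`; it sends the Fourier transform of `T₃(p ⊗ q)` to
that of `q ⊗ p`. -/
def dualT₁ (hφ : H.IsLeftIntegral φ) :
    dualSpace φ ⊗[ℂ] dualSpace φ ≃ₗ[ℂ] dualSpace φ ⊗[ℂ] dualSpace φ :=
  (H.T₃ ≪≫ₗ TensorProduct.congr hφ.fourier hφ.fourier).symm ≪≫ₗ TensorProduct.comm ℂ A A ≪≫ₗ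
    TensorProduct.congr hφ.fourier hφ.fourier

/-- The map `b ⊗ b' ↦ (b ⊗ 1)Δ(b')` of `Â ⊗ Â`; it sends the left Fourier transform of `T₄(q ⊗ p)`
to that of `p ⊗ q`. -/
def dualT₂ (hφ : H.IsLeftIntegral φ) (hS : H.toHopfData.IsAntipode ε S.toLinearMap) :
    dualSpace φ ⊗[ℂ] dualSpace φ ≃ₗ[ℂ] dualSpace φ ⊗[ℂ] dualSpace φ :=
  (H.T₄ ≪≫ₗ TensorProduct.congr (hφ.leftFourier hS) (hφ.leftFourier hS)).symm ≪≫ₗ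
    TensorProduct.comm ℂ A A ≪≫ₗ TensorProduct.congr (hφ.leftFourier hS) (hφ.leftFourier hS)

theorem dualT₁_congr_fourier_T₃ (hφ : H.IsLeftIntegral φ) (p q : A) :
    hφ.dualT₁ (TensorProduct.congr hφ.fourier hφ.fourier (H.T₃ (p ⊗ₜ q))) =
      hφ.fourier q ⊗ₜ hφ.fourier p := by
  simp [dualT₁]

theorem dualT₂_congr_leftFourier_T₄ (hφ : H.IsLeftIntegral φ)
    (hS : H.toHopfData.IsAntipode ε S.toLinearMap) (q p : A) :
    hφ.dualT₂ hS (TensorProduct.congr (hφ.leftFourier hS) (hφ.leftFourier hS) (H.T₄ (q ⊗ₜ p))) =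
      hφ.leftFourier hS p ⊗ₜ hφ.leftFourier hS q := by
  simp [dualT₂]

theorem linearMap_ext_fourier_T₃ {W : Type*} [AddCommGroup W] [Module ℂ W]
    (hφ : H.IsLeftIntegral φ) {f g : dualSpace φ ⊗[ℂ] dualSpace φ →ₗ[ℂ] W}
    (h : ∀ p q, f (TensorProduct.congr hφ.fourier hφ.fourier (H.T₃ (p ⊗ₜ q))) =
      g (TensorProduct.congr hφ.fourier hφ.fourier (H.T₃ (p ⊗ₜ q)))) : f = g :=
  LinearMap.ext fun w => apply_eq_apply_of_equiv_tmul
    (H.T₃ ≪≫ₗ TensorProduct.congr hφ.fourier hφ.fourier) h w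

theorem linearMap_ext_leftFourier_T₄ {W : Type*} [AddCommGroup W] [Module ℂ W]
    (hφ : H.IsLeftIntegral φ) (hS : H.toHopfData.IsAntipode ε S.toLinearMap)
    {f g : dualSpace φ ⊗[ℂ] dualSpace φ →ₗ[ℂ] W}
    (h : ∀ q p, f (TensorProduct.congr (hφ.leftFourier hS) (hφ.leftFourier hS) (H.T₄ (q ⊗ₜ p))) =
      g (TensorProduct.congr (hφ.leftFourier hS) (hφ.leftFourier hS) (H.T₄ (q ⊗ₜ p)))) : f = g :=
  LinearMap.ext fun w => apply_eq_apply_of_equiv_tmul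
    (H.T₄ ≪≫ₗ TensorProduct.congr (hφ.leftFourier hS) (hφ.leftFourier hS)) h w

theorem sliceLeft_dualCounit_comp_dualT₁ (hφ : H.IsLeftIntegral φ) :
    sliceLeft hφ.dualCounit ∘ₗ hφ.dualT₁.toLinearMap = hφ.dualMulTensor :=
  hφ.linearMap_ext_fourier_T₃ fun p q => Subtype.ext <| LinearMap.ext fun x => by
    have slice : sliceRight φ (H.T₃ ((x * p) ⊗ₜ q)) = φ (x * p) • q := hφ.2.1 (x * p) q
    rw [dualMulTensor_congr_fourier, left_T₃, tensorFunctional_eq_sliceRight, slice,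
      LinearMap.comp_apply, LinearEquiv.coe_coe, dualT₁_congr_fourier_T₃]
    simp [dualCounit_fourier, fourier_apply, mul_comm]

theorem sliceRight_dualCounit_comp_dualT₂ (hφ : H.IsLeftIntegral φ)
    (hS : H.toHopfData.IsAntipode ε S.toLinearMap) :
    sliceRight hφ.dualCounit ∘ₗ (hφ.dualT₂ hS).toLinearMap = hφ.dualMulTensor :=
  hφ.linearMap_ext_leftFourier_T₄ hS fun q p => Subtype.ext <| LinearMap.ext fun x => by
    have slice : sliceLeft (rightIntegral φ S) (H.T₄ (q ⊗ₜ (p * x))) =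
        rightIntegral φ S (p * x) • q := hφ.isIntegral.sliceLeft_T₄ hS q (p * x)
    rw [dualMulTensor_congr_leftFourier, rightMul_Δ_T₄, tensorFunctional_eq_sliceLeft, slice,
      LinearMap.comp_apply, LinearEquiv.coe_coe, dualT₂_congr_leftFourier_T₄]
    simp [dualCounit_leftFourier, leftFourier_apply, mul_comm]

theorem dualMulTensor_comp_rTensor_comp_dualT₁ (hφ : H.IsLeftIntegral φ)
    (hS : H.toHopfData.IsAntipode ε S.toLinearMap) :
    hφ.dualMulTensor ∘ₗ rTensor (dualSpace φ) (hφ.dualAntipode hS).toLinearMap ∘ₗ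
      hφ.dualT₁.toLinearMap = sliceLeft hφ.dualCounit :=
  hφ.linearMap_ext_fourier_T₃ fun p q => by
    have counit_fourier : hφ.dualCounit ∘ₗ hφ.fourier.toLinearMap = φ :=
      LinearMap.ext hφ.dualCounit_fourier
    have slice (z : A ⊗[ℂ] A) : sliceLeft hφ.dualCounit
        (TensorProduct.congr hφ.fourier hφ.fourier z) = hφ.fourier (sliceLeft φ z) :=
      (sliceLeft_map hφ.dualCounit hφ.fourier.toLinearMap hφ.fourier.toLinearMap z).trans
        (by rw [counit_fourier]; rfl)
    simp only [LinearMap.comp_apply, LinearEquiv.coe_coe]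
    rw [dualT₁_congr_fourier_T₃, slice, ← hφ.dualMul_dualAntipode_fourier hS]
    simp

theorem dualMulTensor_comp_lTensor_comp_dualT₂ (hφ : H.IsLeftIntegral φ)
    (hS : H.toHopfData.IsAntipode ε S.toLinearMap) :
    hφ.dualMulTensor ∘ₗ lTensor (dualSpace φ) (hφ.dualAntipode hS).toLinearMap ∘ₗ
      (hφ.dualT₂ hS).toLinearMap = sliceRight hφ.dualCounit :=
  hφ.linearMap_ext_leftFourier_T₄ hS fun q p => by
    have counit_leftFourier :
        hφ.dualCounit ∘ₗ (hφ.leftFourier hS).toLinearMap = rightIntegral φ S :=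
      LinearMap.ext (hφ.dualCounit_leftFourier hS)
    have slice (z : A ⊗[ℂ] A) : sliceRight hφ.dualCounit
        (TensorProduct.congr (hφ.leftFourier hS) (hφ.leftFourier hS) z) =
          hφ.leftFourier hS (sliceRight (rightIntegral φ S) z) :=
      (sliceRight_map hφ.dualCounit (hφ.leftFourier hS).toLinearMap
        (hφ.leftFourier hS).toLinearMap z).trans (by rw [counit_leftFourier]; rfl)
    simp only [LinearMap.comp_apply, LinearEquiv.coe_coe]
    rw [dualT₂_congr_leftFourier_T₄, slice, ← hφ.dualMul_leftFourier_dualAntipode hS]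
    simp

theorem tensorPairing_congr_fourier (hφ : H.IsLeftIntegral φ) (z w : A ⊗[ℂ] A) :
    tensorPairing φ (TensorProduct.congr hφ.fourier hφ.fourier z) w =
      tensorFunctional φ φ (w * z) := by
  induction z with
  | zero => simp
  | add y z hy hz => simp only [map_add, LinearMap.add_apply, mul_add, hy, hz]
  | tmul p q =>
    induction w with
    | zero => simp
    | add y z hy hz => simp only [map_add, add_mul, hy, hz]
    | tmul a b => simp [tensorPairing_tmul_tmul, fourier_apply]

theorem tensorPairing_congr_leftFourier (hφ : H.IsLeftIntegral φ)
    (hS : H.toHopfData.IsAntipode ε S.toLinearMap) (z w : A ⊗[ℂ] A) :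
    tensorPairing φ (TensorProduct.congr (hφ.leftFourier hS) (hφ.leftFourier hS) z) w =
      tensorFunctional (rightIntegral φ S) (rightIntegral φ S) (z * w) := by
  induction z with
  | zero => simp
  | add y z hy hz => simp only [map_add, LinearMap.add_apply, add_mul, hy, hz]
  | tmul p q =>
    induction w with
    | zero => simp
    | add y z hy hz => simp only [map_add, mul_add, hy, hz]
    | tmul a b => simp [tensorPairing_tmul_tmul, leftFourier_apply]

theorem isDualT₁_dualT₁ (hφ : H.IsLeftIntegral φ) : IsDualT₁ H φ hφ.dualT₁.toLinearMap :=
  fun b b' a a' => by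
    refine LinearMap.congr_fun (f := LinearMap.applyₗ (a ⊗ₜ a') ∘ₗ tensorPairing φ ∘ₗ
      hφ.dualT₁.toLinearMap) (g := LinearMap.applyₗ (H.T₂ (a ⊗ₜ a')) ∘ₗ tensorPairing φ)
      (hφ.linearMap_ext_fourier_T₃ fun p q => ?_) (b ⊗ₜ b')
    have T₂_mul : H.T₂ (a ⊗ₜ a') * H.T₃ (p ⊗ₜ q) =
        leftMul (tmulOne a) (leftMul (H.Δ a') (H.T₃ (p ⊗ₜ q))) :=
      congrArg (fun m => leftMul m (H.T₃ (p ⊗ₜ q))) (H.of_T₂ a a')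
    simp only [LinearMap.comp_apply, LinearMap.applyₗ_apply_apply, LinearEquiv.coe_coe]
    rw [dualT₁_congr_fourier_T₃, tensorPairing_tmul_tmul, tensorPairing_congr_fourier, T₂_mul,
      left_T₃, tensorFunctional_eq_sliceRight, sliceRight_leftMul_tmulOne, hφ.2.1]
    simp [fourier_apply, mul_smul_comm, mul_comm]

theorem isDualT₂_dualT₂ (hφ : H.IsLeftIntegral φ)
    (hS : H.toHopfData.IsAntipode ε S.toLinearMap) : IsDualT₂ H φ (hφ.dualT₂ hS).toLinearMap :=
  fun b b' a a' => by
    refine LinearMap.congr_fun (f := LinearMap.applyₗ (a ⊗ₜ a') ∘ₗ tensorPairing φ ∘ₗ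
      (hφ.dualT₂ hS).toLinearMap) (g := LinearMap.applyₗ (H.T₁ (a ⊗ₜ a')) ∘ₗ tensorPairing φ)
      (hφ.linearMap_ext_leftFourier_T₄ hS fun q p => ?_) (b ⊗ₜ b')
    have mul_T₁ : H.T₄ (q ⊗ₜ p) * H.T₁ (a ⊗ₜ a') =
        rightMul (oneTmul a') (rightMul (H.Δ a) (H.T₄ (q ⊗ₜ p))) :=
      congrArg (fun m => rightMul m (H.T₄ (q ⊗ₜ p))) (H.of_T₁ a a')
    have slice : sliceLeft (rightIntegral φ S) (H.T₄ (q ⊗ₜ (p * a))) =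
        rightIntegral φ S (p * a) • q := hφ.isIntegral.sliceLeft_T₄ hS q (p * a)
    simp only [LinearMap.comp_apply, LinearMap.applyₗ_apply_apply, LinearEquiv.coe_coe]
    rw [dualT₂_congr_leftFourier_T₄, tensorPairing_tmul_tmul, tensorPairing_congr_leftFourier,
      mul_T₁, rightMul_Δ_T₄, tensorFunctional_eq_sliceLeft, sliceLeft_rightMul_oneTmul, slice]
    simp [leftFourier_apply, smul_mul_assoc]

theorem isDualAntipode_dualAntipode (hφ : H.IsLeftIntegral φ)
    (hS : H.toHopfData.IsAntipode ε S.toLinearMap) :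
    hφ.IsDualAntipode (hφ.dualAntipode hS) := by
  refine ⟨hφ.dualT₁.toLinearMap, (hφ.dualT₂ hS).toLinearMap, hφ.dualCounit, hφ.isDualT₁_dualT₁,
    hφ.isDualT₂_dualT₂ hS, fun b b' => ?_, fun b b' => ?_, fun b b' => ?_, fun b b' => ?_⟩
  · simpa using LinearMap.congr_fun hφ.sliceLeft_dualCounit_comp_dualT₁ (b ⊗ₜ b')
  · simpa using LinearMap.congr_fun (hφ.sliceRight_dualCounit_comp_dualT₂ hS) (b ⊗ₜ b')
  · simpa [rTensor] using
      LinearMap.congr_fun (hφ.dualMulTensor_comp_rTensor_comp_dualT₁ hS) (b ⊗ₜ b')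
  · simpa [lTensor] using
      LinearMap.congr_fun (hφ.dualMulTensor_comp_lTensor_comp_dualT₂ hS) (b ⊗ₜ b')

theorem isDualAntipode_iff (hφ : H.IsLeftIntegral φ)
    (hS : H.toHopfData.IsAntipode ε S.toLinearMap) (SB : dualSpace φ ≃ₗ[ℂ] dualSpace φ) :
    hφ.IsDualAntipode SB ↔ SB = hφ.dualAntipode hS := by
  refine ⟨?_, fun h => h ▸ hφ.isDualAntipode_dualAntipode hS⟩
  rintro ⟨T₁, -, εB, hT₁, -, hεB, -, hSB, -⟩
  obtain rfl : T₁ = hφ.dualT₁.toLinearMap := TensorProduct.ext' fun b b' =>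
    tensorPairing_ext fun a a' => (hT₁ b b' a a').trans (hφ.isDualT₁_dualT₁ b b' a a').symm
  obtain rfl : εB = hφ.dualCounit := sliceLeft_injective <|
    (LinearMap.cancel_right hφ.dualT₁.surjective).1 <| by
      rw [sliceLeft_dualCounit_comp_dualT₁]
      exact TensorProduct.ext' fun b b' => by simpa using hεB b b'
  have dualMulTensor_rTensor : hφ.dualMulTensor ∘ₗ rTensor (dualSpace φ) SB.toLinearMap =
      hφ.dualMulTensor ∘ₗ rTensor (dualSpace φ) (hφ.dualAntipode hS).toLinearMap :=
    (LinearMap.cancel_right hφ.dualT₁.surjective).1 <| by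
      rw [LinearMap.comp_assoc, LinearMap.comp_assoc, dualMulTensor_comp_rTensor_comp_dualT₁]
      exact TensorProduct.ext' fun b b' => by simpa [rTensor] using hSB b b'
  refine LinearEquiv.ext fun b => hφ.dualMul_left_cancel fun b' => ?_
  simpa using LinearMap.congr_fun dualMulTensor_rTensor (b ⊗ₜ b')

theorem eq_iff_forall_dualSpace (hφ : H.IsLeftIntegral φ) {a a' : A} :
    a = a' ↔ ∀ b : dualSpace φ, (b : Module.Dual ℂ A) a = (b : Module.Dual ℂ A) a' := by
  refine ⟨fun h _ => by rw [h], fun h => sub_eq_zero.1 (hφ.isIntegral.op.faithful fun c => ?_)⟩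
  have eval : φ (a * c) = φ (a' * c) := h (hφ.fourier c)
  change φ ((a - a') * c) = 0
  rw [sub_mul, map_sub, eval, sub_self]

theorem counit_fourier_symm_dualMul_dualAntipode (hφ : H.IsLeftIntegral φ)
    (hS : H.toHopfData.IsAntipode ε S.toLinearMap) (b b' : dualSpace φ) :
    ε (hφ.fourier.symm (hφ.dualMul (hφ.dualAntipode hS b') b)) =
      (b' : Module.Dual ℂ A) (hφ.fourier.symm b) := by
  obtain ⟨a, rfl⟩ := hφ.fourier.surjective b
  obtain ⟨c, rfl⟩ := hφ.fourier.surjective b'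
  rw [dualMul_dualAntipode_fourier, LinearEquiv.symm_apply_apply, LinearEquiv.symm_apply_apply,
    apply_sliceLeft]
  exact congrArg φ (hS.isCounit.sliceRight_T₃ a c)

theorem counit_antipodeFourier_symm_dualMul (hφ : H.IsLeftIntegral φ)
    (hS : H.toHopfData.IsAntipode ε S.toLinearMap) (b b' : dualSpace φ) :
    ε ((hφ.antipodeFourier hS).symm (hφ.dualMul b' b)) =
      (b' : Module.Dual ℂ A) ((hφ.antipodeFourier hS).symm b) := by
  obtain ⟨a, rfl⟩ := (hφ.antipodeFourier hS).surjective b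
  obtain ⟨c, rfl⟩ := hφ.fourier.surjective b'
  rw [dualMul_fourier_antipodeFourier, LinearEquiv.symm_apply_apply, LinearEquiv.symm_apply_apply,
    ← apply_sliceLeft]
  exact congrArg φ (hS.isCounit.sliceLeft_T₁ a c)

theorem fourier_symm_eq_iff (hφ : H.IsLeftIntegral φ)
    (hS : H.toHopfData.IsAntipode ε S.toLinearMap) (b : dualSpace φ) (a : A) :
    hφ.fourier.symm b = a ↔ ∀ b' : dualSpace φ, (b' : Module.Dual ℂ A) a =
      ε (hφ.fourier.symm (hφ.dualMul (hφ.dualAntipode hS b') b)) := by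
  simp only [counit_fourier_symm_dualMul_dualAntipode]
  exact eq_comm.trans hφ.eq_iff_forall_dualSpace

theorem antipodeFourier_symm_eq_iff (hφ : H.IsLeftIntegral φ)
    (hS : H.toHopfData.IsAntipode ε S.toLinearMap) (b : dualSpace φ) (a : A) :
    (hφ.antipodeFourier hS).symm b = a ↔ ∀ b' : dualSpace φ, (b' : Module.Dual ℂ A) a =
      ε ((hφ.antipodeFourier hS).symm (hφ.dualMul b' b)) := by
  simp only [counit_antipodeFourier_symm_dualMul]
  exact eq_comm.trans hφ.eq_iff_forall_dualSpace

theorem exists_isAntipode (hφ : H.IsLeftIntegral φ) :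
    ∃ (ε : A →ₙₐ[ℂ] ℂ) (S : A ≃ₗ[ℂ] A),
      H.toHopfData.IsAntipode (ε : A →ₗ[ℂ] ℂ) S.toLinearMap := by
  obtain ⟨ε, hε⟩ := H.toHopfData.exists_isCounit
  obtain ⟨S, hS, -⟩ := hφ.isIntegral.exists_antipode_equiv hε
  exact ⟨{ ε with
    map_smul' := map_smul ε
    map_zero' := map_zero ε
    map_mul' := hε.map_m }, S, hS⟩

end IsLeftIntegral

theorem isCounit_iff {ε : A →ₙₐ[ℂ] ℂ} (hε : H.toHopfData.IsCounit (ε : A →ₗ[ℂ] ℂ))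
    (ε' : A →ₙₐ[ℂ] ℂ) : H.IsCounit ε' ↔ ε' = ε := by
  refine ⟨fun h => ?_, fun h => h ▸ ⟨hε.sliceLeft_T₁, hε.sliceRight_T₂⟩⟩
  have eq : (ε' : A →ₗ[ℂ] ℂ) = ε := hε.eq_of_sliceLeft_T₁ h.1
  exact NonUnitalAlgHom.ext (LinearMap.congr_fun eq)

theorem isAntipode_iff {ε : A →ₙₐ[ℂ] ℂ}
    (hS : H.toHopfData.IsAntipode (ε : A →ₗ[ℂ] ℂ) S.toLinearMap) (S' : A ≃ₗ[ℂ] A) :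
    H.IsAntipode ε S' ↔ S' = S := by
  refine ⟨fun h => ?_, fun h => h ▸ ⟨hS.lift_rTensor_T₁, hS.lift_lTensor_T₂⟩⟩
  have eq : S'.toLinearMap = S.toLinearMap := hS.unique ⟨hS.isCounit, h.1⟩
  exact LinearEquiv.ext (LinearMap.congr_fun eq)

end Dual

end RegularMultiplierHopfAlgebra

end MHA
end

theorem mainTheorem8 {A : Type*} [NonUnitalRing A] [Module ℂ A] [IsScalarTower ℂ A A]
    [SMulCommClass ℂ A A] (H : MHA.RegularMultiplierHopfAlgebra A) (φ : Module.Dual ℂ A)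
    (hφ : H.IsLeftIntegral φ) :
    -- the counit `ε` and the antipode `S` of `A`
    ∃ (ε : A →ₙₐ[ℂ] ℂ) (S : A ≃ₗ[ℂ] A),
      (∀ ε' : A →ₙₐ[ℂ] ℂ, H.IsCounit ε' ↔ ε' = ε) ∧
      (∀ S' : A ≃ₗ[ℂ] A, H.IsAntipode ε S' ↔ S' = S) ∧
      -- the maps `F a = φ(· a)` and `G a = ψ(S(·) a)` are bijections of `A` onto the dual `B`;
      -- the antipode `SB` of `B`, and the functionals `ψh`, `φh` on `B`
      ∃ (F G : A ≃ₗ[ℂ] MHA.dualSpace φ) (SB : MHA.dualSpace φ ≃ₗ[ℂ] MHA.dualSpace φ)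
        (ψh φh : Module.Dual ℂ (MHA.dualSpace φ)),
        (∀ a x : A, (F a : Module.Dual ℂ A) x = φ (x * a)) ∧
        (∀ a x : A, (G a : Module.Dual ℂ A) x = MHA.rightIntegral φ S (S x * a)) ∧
        (∀ SB' : MHA.dualSpace φ ≃ₗ[ℂ] MHA.dualSpace φ, hφ.IsDualAntipode SB' ↔ SB' = SB) ∧
        (∀ (b : MHA.dualSpace φ) (x : A),
          (SB b : Module.Dual ℂ A) x = (b : Module.Dual ℂ A) (S x)) ∧
        (∀ a : A, ψh (F a) = ε a) ∧
        (∀ a : A, φh (G a) = ε a) ∧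
        -- the inverse of `F` sends `b` to the element `ψh(SB(·) b)` of `A`
        (∀ (b : MHA.dualSpace φ) (a : A), F.symm b = a ↔
          ∀ b' : MHA.dualSpace φ, (b' : Module.Dual ℂ A) a = ψh (hφ.dualMul (SB b') b)) ∧
        -- the inverse of `G` sends `b` to the element `φh(· b)` of `A`
        (∀ (b : MHA.dualSpace φ) (a : A), G.symm b = a ↔
          ∀ b' : MHA.dualSpace φ, (b' : Module.Dual ℂ A) a = φh (hφ.dualMul b' b)) := by
  obtain ⟨ε, S, hS⟩ := hφ.exists_isAntipode
  exact ⟨ε, S, MHA.RegularMultiplierHopfAlgebra.isCounit_iff hS.isCounit,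
    MHA.RegularMultiplierHopfAlgebra.isAntipode_iff hS,
    hφ.fourier, hφ.antipodeFourier hS, hφ.dualAntipode hS,
    (ε : A →ₗ[ℂ] ℂ) ∘ₗ hφ.fourier.symm.toLinearMap,
    (ε : A →ₗ[ℂ] ℂ) ∘ₗ (hφ.antipodeFourier hS).symm.toLinearMap,
    hφ.fourier_apply, hφ.antipodeFourier_apply hS, hφ.isDualAntipode_iff hS,
    hφ.dualAntipode_apply hS,
    fun a => congrArg ε (hφ.fourier.symm_apply_apply a),
    fun a => congrArg ε ((hφ.antipodeFourier hS).symm_apply_apply a),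
    hφ.fourier_symm_eq_iff hS, hφ.antipodeFourier_symm_eq_iff hS⟩
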